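/- Let $b_0,b_1,b_2,\dots$ be independent standard Brownian motions on $[0,\infty)$, and for $n\ge 1$ let $C_n(t)$ be the $n\times n$ random circulant matrix whose $(i,j)$-th entry is $b_{(j-i)\bmod n}(t)/\sqrt n$. For an integer $p\ge 2$ put $$w_p(t)=w_p^{(n)}(t)=\frac1{\sqrt n}\Bigl\{\operatorname{Tr}\bigl(C_n(t)^p\bigr)-\mathrm E\bigl[\operatorname{Tr}\bigl(C_n(t)^p\bigr)\bigr]\Bigr\},\qquad t\ge 0,$$ where $\operatorname{Tr}(C_n(t)^p)$ is integrable for every $t$ and $w_p$ has almost surely continuous paths. Then there is a centred Gaussian process $\{N_p(t);t\ge 0\}$ with continuous paths and covariance $$\mathrm E[N_p(t_1)N_p(t_2)]=(\min\{t_1,t_2\})^p\,p!\sum_{s=0}^{p-1}f_p(s),\qquad f_p(s)=\frac1{(p-1)!}\sum_{k=0}^{s}(-1)^k\binom pk(s-k)^{p-1},$$ and for each fixed $p\ge 2$, as $n\to\infty$, $$\{w_p(t);t\ge 0\}\ \xrightarrow{\ \mathcal D\ }\ \{N_p(t);t\ge 0\}$$ in distribution on $C[0,\infty)$, that is, the laws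 of $w_p$ converge weakly to the law of $N_p$ as probability measures on the Borel sets of $C[0,\infty)$ with the topology of uniform convergence on compact sets. -/

import Mathlib

open MeasureTheory ProbabilityTheory Filter Topology
open scoped NNReal Nat

namespace CirculantFluctuation

/-- The space `C[0,∞)` of continuous real functions on `[0,∞)` carries Mathlib's compact-open
topology, i.e. the topology of uniform convergence on compact sets, and its Borel σ-field. -/
instance instMeasurableSpacePaths : MeasurableSpace C(ℝ≥0, ℝ) := borel _

instance instBorelSpacePaths : BorelSpace C(ℝ≥0, ℝ) := ⟨rfl⟩

/-- The random element of `C[0,∞)` given by the paths of a real process with almost surely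
continuous paths (a discontinuous path is replaced by the zero path). -/
noncomputable def path {Ω : Type*} (X : ℝ≥0 → Ω → ℝ) (ω : Ω) : C(ℝ≥0, ℝ) :=
  ContinuousMap.mkD (fun t ↦ X t ω) 0

/-- The random circulant matrix `C_n(t)`, whose `(i, j)` entry is
`b_{(j - i) mod n}(t) / √n` (subtraction in `Fin n` is modulo `n`). -/
noncomputable def circ {Ω : Type*} (b : ℕ → ℝ≥0 → Ω → ℝ) (n : ℕ) (t : ℝ≥0) (ω : Ω) :
    Matrix (Fin n) (Fin n) ℝ :=
  Matrix.of fun i j ↦ b (j - i : Fin n).val t ω / √(n : ℝ)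

/-- The fluctuation `w_p(t) = n^{-1/2} (Tr C_n(t)^p - E[Tr C_n(t)^p])`. -/
noncomputable def fluct {Ω : Type*} [MeasurableSpace Ω] (P : Measure Ω)
    (b : ℕ → ℝ≥0 → Ω → ℝ) (p n : ℕ) (t : ℝ≥0) (ω : Ω) : ℝ :=
  1 / √(n : ℝ) * ((circ b n t ω ^ p).trace - ∫ ω', (circ b n t ω' ^ p).trace ∂P)

/-- `f_p(s) = 1/(p-1)! ∑_{k=0}^s (-1)^k (p choose k) (s-k)^{p-1}`, used for `p ≥ 2`. -/
noncomputable def f (p s : ℕ) : ℝ :=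
  1 / ((p - 1)! : ℝ) *
    ∑ k ∈ Finset.range (s + 1), (-1 : ℝ) ^ k * (p.choose k : ℝ) * ((s : ℝ) - (k : ℝ)) ^ (p - 1)

/-- `N` is a version of the limit process `N_p`: a centred Gaussian process with almost surely
continuous paths and `E[N(s) N(t)] = min(s,t)^p p! ∑_{k=0}^{p-1} f_p(k)`. -/
structure IsLimitProcess {Ω : Type*} [MeasurableSpace Ω] (p : ℕ) (N : ℝ≥0 → Ω → ℝ)
    (P : Measure Ω) : Prop where
  gaussian : IsGaussianProcess N P
  continuous_paths : ∀ᵐ ω ∂P, Continuous fun t ↦ N t ω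
  mean_zero : ∀ t, ∫ ω, N t ω ∂P = 0
  covariance : ∀ s t, ∫ ω, N s ω * N t ω ∂P =
    ((min s t : ℝ≥0) : ℝ) ^ p * (p ! : ℝ) * ∑ k ∈ Finset.range p, f p k

end CirculantFluctuation

open CirculantFluctuation

/-! The discrete Fourier basis diagonalises every circulant matrix, so the trace of the `p`-th power
is the sum of the `p`-th powers of the eigenvalues (`trace_circulant_pow`). For real entries the
eigenvalues of index `k` and `n - k` are conjugate, and only the indices `0` and, for even `n`, `n /
2` are self-paired. The rows giving `√2 Re λ` and `√2 Im λ` for the other pairs are orthonormal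
(`sum_pairRow_mul`), and an orthonormal transformation of independent Brownian motions yields
independent Brownian motions (`IsBrownianFamily.sum_orthonormal`). Hence the trace is a sum of `(n -
1) / 2` independent copies of `2 Re Z(t)ᵖ`, with `Z` a complex Brownian motion, plus at most two
powers of real Brownian motions.

Rotation invariance of `Z` gives `E Z(s)ᵖ = 0` and `E Z(s)ᵖ Z(t)ᵖ = 0`, while `E Z(s)ᵖ conj(Z(t))ᵖ =
p! min(s,t)ᵖ`. So `2 Re Zᵖ` has covariance `2 p! min(s,t)ᵖ`, and since there are about `n / 2`
pairs, division by `n` leaves `p! min(s,t)ᵖ`. This is the stated covariance because the numbers `f p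
k` sum to one (`sum_range_f`). The classical central limit theorem, applied to linear combinations
over finitely many times, gives the finite dimensional limits (`tendsto_integral_exp_fluct`); the
real eigenvalues are `O(n^{-1/2})` in `L¹`.

Tightness is Kolmogorov's criterion: the fourth moment of a sum of independent centred increments is
quadratic in the number of terms, which gives a bound `C (t - s)²` uniform in `n`
(`exists_integral_fluct_sub_pow_four_le`). Tightness and convergence of characteristic functions
together give weak convergence (`tendstoInDistribution_path`). The limit is realised as `√(p!)
B(tᵖ)`. -/

namespace CirculantFluctuation

/-! ### Continuity moduli, compactness and tightness in the path space -/

/-- The left endpoint of the dyadic interval of length `2⁻ᵐ` that contains `s`. -/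
noncomputable def dyadicFloor (m : ℕ) (s : ℝ≥0) : ℝ≥0 := (⌊s * 2 ^ m⌋₊ : ℝ≥0) / 2 ^ m

lemma dyadicFloor_le (m : ℕ) (s : ℝ≥0) : dyadicFloor m s ≤ s := by
  unfold dyadicFloor
  rw [div_le_iff₀ (by positivity)]
  exact Nat.floor_le zero_le

lemma lt_dyadicFloor_add (m : ℕ) (s : ℝ≥0) : s < dyadicFloor m s + 1 / 2 ^ m := by
  unfold dyadicFloor
  rw [← add_div, lt_div_iff₀ (by positivity)]
  exact Nat.lt_floor_add_one _

lemma tendsto_dyadicFloor (s : ℝ≥0) : Tendsto (fun m ↦ dyadicFloor m s) atTop (𝓝 s) := by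
  have h2 : Tendsto (fun m : ℕ ↦ s - 1 / 2 ^ m) atTop (𝓝 (s - 0)) := by
    refine Tendsto.sub tendsto_const_nhds ?_
    simp_rw [← one_div_pow]
    refine NNReal.tendsto_pow_atTop_nhds_zero_of_lt_one ?_
    rw [div_lt_one (by norm_num)]
    norm_num
  rw [tsub_zero] at h2
  refine tendsto_of_tendsto_of_tendsto_of_le_of_le h2 tendsto_const_nhds (fun m ↦ ?_)
    fun m ↦ dyadicFloor_le m s
  exact tsub_le_iff_right.2 (lt_dyadicFloor_add m s).le

lemma floor_mul_two_pow_lt {N : ℕ} {s : ℝ≥0} (hs : s < N) (m : ℕ) :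
    ⌊s * 2 ^ m⌋₊ < N * 2 ^ m := by
  rw [Nat.floor_lt zero_le]
  push_cast
  gcongr

/-- Control of the dyadic increments of a continuous function at all scales gives a modulus
of continuity. -/
lemma dist_le_of_dyadic {f : ℝ≥0 → ℝ} (hf : Continuous f) {r L : ℝ} (hr0 : 0 ≤ r) (hr1 : r < 1)
    (hL : 0 ≤ L) {N : ℕ}
    (h : ∀ m k : ℕ, k + 1 ≤ N * 2 ^ m →
      dist (f ((k + 1 : ℕ) / 2 ^ m)) (f ((k : ℕ) / 2 ^ m)) ≤ L * r ^ m)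
    (m : ℕ) {s t : ℝ≥0} (hs : s < N) (ht : t < N) (hst : dist s t ≤ 1 / 2 ^ m) :
    dist (f s) (f t) ≤ L * (1 + 2 / (1 - r)) * r ^ m := by
  wlog hle : s ≤ t generalizing s t
  · rw [dist_comm]
    exact this ht hs (by rwa [dist_comm]) (le_of_not_ge hle)
  -- Chaining: each point is the limit of its dyadic floors, and passing from level `j` to `j + 1`
  -- moves the floor by at most one dyadic step. The two tails from `s` and `t`, plus one step
  -- between the floors at level `m`, account for `1 + 2 / (1 - r)`.
  have key : ∀ u : ℝ≥0, u < N → dist (f (dyadicFloor m u)) (f u) ≤ L * r ^ m / (1 - r) := by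
    intro u hu
    refine dist_le_of_le_geometric_of_tendsto (f := fun j ↦ f (dyadicFloor j u)) r L hr1
      (fun j ↦ ?_) ((hf.tendsto u).comp (tendsto_dyadicFloor u)) m
    have h1 : ⌊u * 2 ^ (j + 1)⌋₊ = 2 * ⌊u * 2 ^ j⌋₊ ∨
        ⌊u * 2 ^ (j + 1)⌋₊ = 2 * ⌊u * 2 ^ j⌋₊ + 1 := by
      have ha : (⌊u * 2 ^ j⌋₊ : ℝ≥0) ≤ u * 2 ^ j := Nat.floor_le zero_le
      have hb : u * 2 ^ j < (⌊u * 2 ^ j⌋₊ : ℝ≥0) + 1 := Nat.lt_floor_add_one _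
      have hc : 2 * ⌊u * 2 ^ j⌋₊ ≤ ⌊u * 2 ^ (j + 1)⌋₊ := by
        apply Nat.le_floor
        push_cast
        rw [pow_succ, ← mul_assoc, mul_comm]
        gcongr
      have hd : ⌊u * 2 ^ (j + 1)⌋₊ < 2 * ⌊u * 2 ^ j⌋₊ + 2 := by
        rw [Nat.floor_lt zero_le]
        push_cast
        calc u * 2 ^ (j + 1) = 2 * (u * 2 ^ j) := by ring
          _ < 2 * (⌊u * 2 ^ j⌋₊ + 1) := by gcongr
          _ = _ := by ring
      omega
    have h2 : (⌊u * 2 ^ j⌋₊ : ℝ≥0) / 2 ^ j = (2 * ⌊u * 2 ^ j⌋₊ : ℕ) / 2 ^ (j + 1) := by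
      push_cast
      rw [pow_succ, mul_comm (2 ^ j : ℝ≥0), mul_div_mul_left _ _ two_ne_zero]
    show dist (f (dyadicFloor j u)) (f (dyadicFloor (j + 1) u)) ≤ _
    have hlt := floor_mul_two_pow_lt hu (j + 1)
    unfold dyadicFloor
    rw [h2]
    rcases h1 with h1 | h1
    · rw [h1, dist_self]
      positivity
    · rw [h1] at hlt ⊢
      rw [dist_comm]
      refine (h (j + 1) (2 * ⌊u * 2 ^ j⌋₊) hlt.le).trans ?_
      exact mul_le_mul_of_nonneg_left (pow_le_pow_of_le_one hr0 hr1.le (Nat.le_succ j)) hL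
  have hmid : dist (f (dyadicFloor m s)) (f (dyadicFloor m t)) ≤ L * r ^ m := by
    have hmono : ⌊s * 2 ^ m⌋₊ ≤ ⌊t * 2 ^ m⌋₊ := Nat.floor_mono (by gcongr)
    have hup : ⌊t * 2 ^ m⌋₊ < ⌊s * 2 ^ m⌋₊ + 2 := by
      rw [Nat.floor_lt zero_le]
      push_cast
      have hts : (t : ℝ) ≤ s + 1 / 2 ^ m := by
        rw [NNReal.dist_eq, abs_sub_comm] at hst
        linarith [le_abs_self ((t : ℝ) - s)]
      have hb : s * 2 ^ m < (⌊s * 2 ^ m⌋₊ : ℝ≥0) + 1 := Nat.lt_floor_add_one _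
      have hts' : t ≤ s + 1 / 2 ^ m := by
        rw [← NNReal.coe_le_coe]
        push_cast
        exact hts
      calc t * 2 ^ m ≤ (s + 1 / 2 ^ m) * 2 ^ m := by gcongr
        _ = s * 2 ^ m + 1 := by field_simp
        _ < (⌊s * 2 ^ m⌋₊ : ℝ≥0) + 1 + 1 := by gcongr
        _ = _ := by ring
    have hlt := floor_mul_two_pow_lt ht m
    unfold dyadicFloor
    obtain h1 | h1 : ⌊t * 2 ^ m⌋₊ = ⌊s * 2 ^ m⌋₊ ∨ ⌊t * 2 ^ m⌋₊ = ⌊s * 2 ^ m⌋₊ + 1 := by omega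
    · rw [h1, dist_self]
      positivity
    · rw [h1] at hlt ⊢
      rw [dist_comm]
      exact h m _ hlt.le
  have h1 := key s hs
  have h2 := key t ht
  calc dist (f s) (f t) ≤ dist (f s) (f (dyadicFloor m s)) +
        dist (f (dyadicFloor m s)) (f (dyadicFloor m t)) + dist (f (dyadicFloor m t)) (f t) :=
        dist_triangle4 _ _ _ _
    _ ≤ L * r ^ m / (1 - r) + L * r ^ m + L * r ^ m / (1 - r) := by
        rw [dist_comm (f s)]
        gcongr
    _ = _ := by ring

/-- The paths vanishing at `0` whose modulus of continuity on `[0, N)` at scale `2⁻ᵐ` is at most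
`L N * r ^ m`. -/
def modulusSet (r : ℝ) (L : ℕ → ℝ) : Set C(ℝ≥0, ℝ) :=
  {g | g 0 = 0 ∧ ∀ (N m : ℕ) (s t : ℝ≥0), s < N → t < N → dist s t ≤ 1 / 2 ^ m →
    dist (g s) (g t) ≤ L N * r ^ m}

lemma exists_pow_mul_lt {r c : ℝ} (hr0 : 0 ≤ r) (hr1 : r < 1) {ε : ℝ} (hε : 0 < ε) :
    ∃ m : ℕ, c * r ^ m < ε := by
  have h : Tendsto (fun m : ℕ ↦ c * r ^ m) atTop (𝓝 (c * 0)) :=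
    (tendsto_pow_atTop_nhds_zero_of_lt_one hr0 hr1).const_mul c
  rw [mul_zero] at h
  exact (h.eventually_lt_const hε).exists

/-- Arzelà–Ascoli: the modulus gives equicontinuity, and together with the value at `0` it bounds
each evaluation. The conditions are closed under pointwise limits. -/
lemma isCompact_modulusSet {r : ℝ} (hr0 : 0 ≤ r) (hr1 : r < 1) (L : ℕ → ℝ) :
    IsCompact (modulusSet r L) := by
  -- Stated for bare functions, because it must also show that every function satisfying the modulus
  -- conditions is continuous.
  have equi : ∀ (x : ℝ≥0) (ε : ℝ), 0 < ε → ∃ δ > 0, ∀ y, dist x y < δ → ∀ g : ℝ≥0 → ℝ,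
      (∀ (N m : ℕ) (s t : ℝ≥0), s < N → t < N → dist s t ≤ 1 / 2 ^ m →
        dist (g s) (g t) ≤ L N * r ^ m) → dist (g x) (g y) < ε := by
    intro x ε hε
    obtain ⟨N, hN⟩ := exists_nat_gt (x + 1)
    obtain ⟨m, hm⟩ := exists_pow_mul_lt (c := L N) hr0 hr1 hε
    refine ⟨1 / 2 ^ m, by positivity, fun y hy g hg ↦ ?_⟩
    refine (hg N m x y ((lt_add_one x).trans hN) ?_ hy.le).trans_lt hm
    refine lt_of_le_of_lt ?_ hN
    rw [NNReal.dist_eq] at hy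
    have h1 : (1 : ℝ) / 2 ^ m ≤ 1 := by
      rw [div_le_one (by positivity)]
      exact one_le_pow₀ (by norm_num)
    rw [← NNReal.coe_le_coe]
    push_cast
    have := neg_abs_le ((x : ℝ) - y)
    linarith
  refine ArzelaAscoli.isCompact_of_equicontinuous _ ?_ ?_
  · have himage : ContinuousMap.toFun '' modulusSet r L = {g : ℝ≥0 → ℝ | g 0 = 0 ∧
        ∀ (N m : ℕ) (s t : ℝ≥0), s < N → t < N → dist s t ≤ 1 / 2 ^ m →
          dist (g s) (g t) ≤ L N * r ^ m} := by
      ext g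
      constructor
      · rintro ⟨g, hg, rfl⟩
        exact hg
      · intro hg
        have hc : Continuous g := by
          rw [Metric.continuous_iff]
          intro x ε hε
          obtain ⟨δ, hδ, h⟩ := equi x ε hε
          exact ⟨δ, hδ, fun y hy ↦ by rw [dist_comm]; exact h y (by rwa [dist_comm]) g hg.2⟩
        exact ⟨⟨g, hc⟩, hg, rfl⟩
    rw [himage]
    choose N hN using fun t : ℝ≥0 ↦ exists_nat_gt t
    refine IsCompact.of_isClosed_subset
      (isCompact_univ_pi fun t : ℝ≥0 ↦ isCompact_closedBall (0 : ℝ) ((N t : ℝ) * L (N t))) ?_ ?_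
    · simp only [Set.ofPred_and, Set.ofPred_forall]
      refine IsClosed.inter (isClosed_eq (continuous_apply _) continuous_const) ?_
      refine isClosed_iInter fun N ↦ isClosed_iInter fun m ↦ isClosed_iInter fun s ↦
        isClosed_iInter fun t ↦ isClosed_iInter fun _ ↦ isClosed_iInter fun _ ↦
        isClosed_iInter fun _ ↦ isClosed_le (by fun_prop) continuous_const
    · intro g hg t _
      rw [mem_closedBall_zero_iff]
      -- Walk back to `0` in unit steps, each costing at most the modulus at scale `m = 0`.
      have hind : ∀ k : ℕ, ∀ u : ℝ≥0, u < N t → u ≤ k → ‖g u‖ ≤ k * L (N t) := by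
        intro k
        induction k with
        | zero =>
          intro u _ hu
          have : u = 0 := by simpa using hu
          simp [this, hg.1]
        | succ k ih =>
          intro u hu huk
          have h1 := ih (u - 1) (tsub_le_self.trans_lt hu) (by
            rw [tsub_le_iff_right]; exact_mod_cast huk)
          have h2 : dist (g u) (g (u - 1)) ≤ L (N t) * r ^ 0 := by
            refine hg.2 (N t) 0 u (u - 1) hu (tsub_le_self.trans_lt hu) ?_
            rw [NNReal.dist_eq, pow_zero, div_one]
            rcases le_total u 1 with h | h
            · rw [tsub_eq_zero_of_le h]
              simpa using h
            · rw [NNReal.coe_sub h]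
              simp
          rw [Real.dist_eq, ← Real.norm_eq_abs, pow_zero, mul_one] at h2
          calc ‖g u‖ = ‖(g u - g (u - 1)) + g (u - 1)‖ := by rw [sub_add_cancel]
            _ ≤ ‖g u - g (u - 1)‖ + ‖g (u - 1)‖ := norm_add_le _ _
            _ ≤ L (N t) + k * L (N t) := add_le_add h2 h1
            _ = _ := by push_cast; ring
      exact hind (N t) t (hN t) (hN t).le
  · intro x U hU
    obtain ⟨ε, hε, hεU⟩ := Metric.mem_uniformity_dist.1 hU
    obtain ⟨δ, hδ, h⟩ := equi x ε hε
    filter_upwards [Metric.ball_mem_nhds x hδ] with y hy g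
    exact hεU (h y (by rwa [dist_comm]) g g.2.2)

/-! ### Measurability, tightness and weak convergence on `C[0,∞)`. -/

section PathSpace

variable {Ω : Type*} [MeasurableSpace Ω] {P : Measure Ω}

lemma path_apply {Ω : Type*} {X : ℝ≥0 → Ω → ℝ} {ω : Ω} (h : Continuous fun t ↦ X t ω) (t : ℝ≥0) :
    path X ω t = X t ω :=
  ContinuousMap.mkD_apply_of_continuous h

/-- A map into the path space is a.e. measurable as soon as its evaluations are. -/
lemma aemeasurable_of_eval {g : Ω → C(ℝ≥0, ℝ)} (h : ∀ t, AEMeasurable (fun ω ↦ g ω t) P) :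
    AEMeasurable g P := by
  let D : Set ℝ≥0 := TopologicalSpace.denseSeq ℝ≥0 |> Set.range
  have hD : D.Countable := Set.countable_range _
  have hDd : Dense D := TopologicalSpace.denseRange_denseSeq ℝ≥0
  have : Countable D := hD
  let e : C(ℝ≥0, ℝ) → (D → ℝ) := fun f d ↦ f d
  -- An injective continuous map out of a Polish space is a measurable embedding, so evaluations at
  -- a countable dense set generate the Borel sets.
  have he : MeasurableEmbedding e := by
    refine Continuous.measurableEmbedding (by fun_prop) fun f g hfg ↦ ?_
    refine DFunLike.coe_injective (Continuous.ext_on hDd f.continuous g.continuous fun d hd ↦ ?_)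
    exact congrFun hfg ⟨d, hd⟩
  rw [← he.aemeasurable_comp_iff]
  exact aemeasurable_pi_lambda _ fun d ↦ h d

lemma aemeasurable_path {X : ℝ≥0 → Ω → ℝ} (hX : ∀ t, AEMeasurable (X t) P)
    (hc : ∀ᵐ ω ∂P, Continuous fun t ↦ X t ω) : AEMeasurable (path X) P := by
  refine aemeasurable_of_eval fun t ↦ (hX t).congr ?_
  filter_upwards [hc] with ω hω
  rw [path_apply hω]

lemma measurable_eval (t : ℝ≥0) : Measurable fun g : C(ℝ≥0, ℝ) ↦ g t :=
  (continuous_eval_const t).measurable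

/-- **Kolmogorov's tightness criterion** on `C[0,∞)`, with fourth moments. -/
theorem isTightMeasureSet_of_moment [IsProbabilityMeasure P] {W : ℕ → ℝ≥0 → Ω → ℝ}
    (hm : ∀ n t, AEMeasurable (W n t) P) (hc : ∀ n, ∀ᵐ ω ∂P, Continuous fun t ↦ W n t ω)
    (h0 : ∀ n, ∀ᵐ ω ∂P, W n 0 ω = 0) {C : ℕ → ℝ} (hC0 : ∀ N, 0 ≤ C N)
    (hC : ∀ (N n : ℕ) (s t : ℝ≥0), s ≤ t → t ≤ N →
      ∫⁻ ω, ‖W n t ω - W n s ω‖ₑ ^ 4 ∂P ≤ ENNReal.ofReal (C N * ((t : ℝ) - s) ^ 2)) :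
    IsTightMeasureSet {P.map (path (W n)) | n} := by
  rw [isTightMeasureSet_iff_exists_isCompact_measure_compl_le]
  intro ε hε
  obtain ⟨δ, hδ0, hδε⟩ : ∃ δ : ℝ, 0 < δ ∧ ENNReal.ofReal δ ≤ ε := by
    rcases eq_or_ne ε ⊤ with rfl | h
    · exact ⟨1, one_pos, le_top⟩
    · exact ⟨ε.toReal, ENNReal.toReal_pos hε.ne' h, by rw [ENNReal.ofReal_toReal h]⟩
  -- At level `m` there are `N 2ᵐ` dyadic increments, and Markov bounds each bad event by a multiple
  -- of `4⁻ᵐ / r^(4m)`. The total is of order `ρᵐ` with `ρ = 1 / (2 r⁴)`, so `r` has to satisfy `1/2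
  -- < r⁴ < 1`.
  let r : ℝ := 9 / 10
  let ρ : ℝ := 1 / (2 * r ^ 4)
  have hr0 : 0 < r := by norm_num [r]
  have hr1 : r < 1 := by norm_num [r]
  have hρ0 : 0 < ρ := by positivity
  have hρ1 : ρ < 1 := by norm_num [ρ, r]
  -- Chosen so that the bad events on `[0, N)` have total mass at most `δ 2^{-(N+1)}`. The maximum
  -- with `1` gives `L ≤ L⁴`.
  let L : ℕ → ℝ := fun N ↦ max 1 (N * C N * 2 ^ (N + 1) / (δ * (1 - ρ)))
  have hL1 : ∀ N, 1 ≤ L N := fun N ↦ le_max_left _ _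
  have hL0 : ∀ N, 0 < L N := fun N ↦ one_pos.trans_le (hL1 N)
  let a : ℕ → ℝ := fun N ↦ N * C N / L N ^ 4
  have ha0 : ∀ N, 0 ≤ a N := fun N ↦
    div_nonneg (mul_nonneg (Nat.cast_nonneg _) (hC0 N)) (pow_nonneg (hL0 N).le _)
  have ha : ∀ N, a N / (1 - ρ) ≤ δ * (1 / 2) ^ (N + 1) := by
    intro N
    have h1 : N * C N * 2 ^ (N + 1) / (δ * (1 - ρ)) ≤ L N ^ 4 :=
      (le_max_right _ _).trans (le_self_pow₀ (hL1 N) (by norm_num))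
    have h2 : 0 < 1 - ρ := by linarith
    rw [div_le_iff₀ (by positivity)] at h1
    rw [div_le_iff₀ h2, div_le_iff₀ (by have := hL0 N; positivity)]
    have h3 : (1 / 2 : ℝ) ^ (N + 1) * 2 ^ (N + 1) = 1 := by rw [← mul_pow]; norm_num
    calc N * C N = (N * C N * 2 ^ (N + 1)) * (1 / 2) ^ (N + 1) := by
          rw [mul_assoc, mul_comm (2 ^ (N + 1) : ℝ), h3, mul_one]
      _ ≤ (L N ^ 4 * (δ * (1 - ρ))) * (1 / 2) ^ (N + 1) := by gcongr
      _ = _ := by ring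
  refine ⟨modulusSet r (fun N ↦ L N * (1 + 2 / (1 - r))), isCompact_modulusSet hr0.le hr1 _, ?_⟩
  rintro _ ⟨n, rfl⟩
  have hmeas := aemeasurable_path (hm n) (hc n)
  rw [Measure.map_apply_of_aemeasurable hmeas
    (isCompact_modulusSet hr0.le hr1 _).isClosed.measurableSet.compl]
  let bad : ℕ → ℕ → ℕ → Set Ω := fun N m k ↦
    {ω | ENNReal.ofReal ((L N * r ^ m) ^ 4) ≤
      ‖W n ((k + 1 : ℕ) / 2 ^ m) ω - W n ((k : ℕ) / 2 ^ m) ω‖ₑ ^ 4}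
  have hbad : ∀ N m k, k < N * 2 ^ m →
      P (bad N m k) ≤ ENNReal.ofReal (C N * (1 / 4) ^ m / (L N * r ^ m) ^ 4) := by
    intro N m k hk
    have hpos : 0 < (L N * r ^ m) ^ 4 := by have := hL0 N; positivity
    refine (meas_ge_le_lintegral_div ?_ ?_ ENNReal.ofReal_ne_top).trans ?_
    · exact (((hm n _).sub (hm n _)).enorm).pow_const _
    · simpa using hpos
    · rw [ENNReal.ofReal_div_of_pos hpos]
      gcongr
      refine (hC N n _ _ ?_ ?_).trans (le_of_eq ?_)
      · gcongr
        simp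
      · rw [div_le_iff₀ (by positivity)]
        exact_mod_cast hk
      · congr 2
        push_cast
        rw [← sub_div, add_sub_cancel_left, div_pow, one_pow, ← pow_mul, mul_comm m 2, pow_mul,
          one_div_pow]
        norm_num
  have hsub : (path (W n) ⁻¹' (modulusSet r fun N ↦ L N * (1 + 2 / (1 - r)))ᶜ) ≤ᵐ[P]
      (⋃ N, ⋃ m, ⋃ k ∈ Finset.range (N * 2 ^ m), bad N m k : Set Ω) := by
    filter_upwards [hc n, h0 n] with ω hcω h0ω hω
    by_contra hnot
    have hnot' : ω ∉ (⋃ N, ⋃ m, ⋃ k ∈ Finset.range (N * 2 ^ m), bad N m k) := hnot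
    simp only [Set.mem_iUnion, not_exists, Finset.mem_range] at hnot'
    refine hω ⟨by rw [path_apply hcω, h0ω], fun N m s t hs ht hst ↦ ?_⟩
    rw [path_apply hcω, path_apply hcω]
    refine dist_le_of_dyadic (f := fun t ↦ W n t ω) hcω hr0.le hr1 (hL0 N).le (fun m k hk ↦ ?_)
      m hs ht hst
    have h1 := hnot' N m k hk
    simp only [bad, Set.mem_ofPred_eq, not_le] at h1
    rw [Real.dist_eq]
    by_contra hlt
    rw [not_le] at hlt
    refine absurd h1 (not_lt.2 ?_)
    rw [← ofReal_norm, ← ENNReal.ofReal_pow (norm_nonneg _)]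
    refine ENNReal.ofReal_le_ofReal (pow_le_pow_left₀ ?_ hlt.le _)
    have := hL0 N
    positivity
  have h1ρ : 0 < 1 - ρ := by linarith
  calc P (path (W n) ⁻¹' (modulusSet r fun N ↦ L N * (1 + 2 / (1 - r)))ᶜ)
      ≤ P (⋃ N, ⋃ m, ⋃ k ∈ Finset.range (N * 2 ^ m), bad N m k) := measure_mono_ae hsub
    _ ≤ ∑' N, ∑' m, ∑ k ∈ Finset.range (N * 2 ^ m), P (bad N m k) := by
        refine (measure_iUnion_le _).trans (ENNReal.tsum_le_tsum fun N ↦ ?_)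
        refine (measure_iUnion_le _).trans (ENNReal.tsum_le_tsum fun m ↦ ?_)
        exact measure_biUnion_finset_le _ _
    _ ≤ ∑' N, ∑' m, ENNReal.ofReal (a N * ρ ^ m) := by
        refine ENNReal.tsum_le_tsum fun N ↦ ENNReal.tsum_le_tsum fun m ↦ ?_
        refine (Finset.sum_le_sum fun k hk ↦ hbad N m k (Finset.mem_range.1 hk)).trans
          (le_of_eq ?_)
        rw [Finset.sum_const, Finset.card_range, nsmul_eq_mul, ← ENNReal.ofReal_natCast,
          ← ENNReal.ofReal_mul (Nat.cast_nonneg _)]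
        congr 1
        have := (hL0 N).ne'
        simp only [a, ρ]
        push_cast
        rw [mul_pow, ← pow_mul, one_div_pow (2 * r ^ 4), one_div_pow, mul_pow, ← pow_mul,
          mul_comm m 4]
        have h4 : (4 : ℝ) ^ m = 2 ^ m * 2 ^ m := by rw [← mul_pow]; norm_num
        rw [h4]
        field_simp
    _ ≤ ∑' N, ENNReal.ofReal (δ * (1 / 2) ^ (N + 1)) := by
        refine ENNReal.tsum_le_tsum fun N ↦ ?_
        rw [← ENNReal.ofReal_tsum_of_nonneg
          (fun m ↦ mul_nonneg (ha0 N) (pow_nonneg hρ0.le m))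
          ((summable_geometric_of_lt_one hρ0.le hρ1).mul_left _),
          tsum_mul_left, tsum_geometric_of_lt_one hρ0.le hρ1, ← div_eq_mul_inv]
        exact ENNReal.ofReal_le_ofReal (ha N)
    _ = ENNReal.ofReal δ := by
        have hs : Summable fun N : ℕ ↦ δ * (1 / 2 : ℝ) ^ (N + 1) :=
          ((summable_geometric_of_lt_one (by norm_num) (by norm_num)).comp_injective
            (add_left_injective 1)).mul_left δ
        rw [← ENNReal.ofReal_tsum_of_nonneg (fun m ↦ by positivity) hs, tsum_mul_left]
        simp_rw [pow_succ]
        rw [tsum_mul_right, tsum_geometric_two]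
        norm_num
    _ ≤ ε := hδε


/-- The pairing of a path with a finitely supported combination of evaluations. -/
noncomputable def evalPairing : C(ℝ≥0, ℝ) →ₗ[ℝ] (ℝ≥0 →₀ ℝ) →ₗ[ℝ] ℝ :=
  LinearMap.mk₂ ℝ (fun v w ↦ w.sum fun t c ↦ c * v t)
    (fun v v' w ↦ by simp [Finsupp.sum, mul_add, Finset.sum_add_distrib])
    (fun c v w ↦ by simp [Finsupp.sum, Finset.mul_sum, mul_left_comm])
    (fun v w w' ↦ Finsupp.sum_add_index' (by simp) (by intros; ring))
    (fun c v w ↦ by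
      rw [Finsupp.sum_smul_index' (by simp), Finsupp.smul_sum]
      simp [mul_assoc])

lemma evalPairing_apply (v : C(ℝ≥0, ℝ)) (w : ℝ≥0 →₀ ℝ) :
    evalPairing v w = w.sum fun t c ↦ c * v t := rfl

lemma continuous_evalPairing [TopologicalSpace (ℝ≥0 →₀ ℝ)] [DiscreteTopology (ℝ≥0 →₀ ℝ)] :
    Continuous fun p : C(ℝ≥0, ℝ) × (ℝ≥0 →₀ ℝ) ↦ evalPairing p.1 p.2 := by
  rw [continuous_prod_of_discrete_right]
  intro w
  simp only [evalPairing_apply, Finsupp.sum]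
  fun_prop

/-- On the path space, tightness and convergence of the characteristic functions of all finite
combinations of evaluations imply weak convergence. -/
theorem tendsto_of_tight_of_tendsto_char {μ : ℕ → ProbabilityMeasure C(ℝ≥0, ℝ)}
    {μ₀ : ProbabilityMeasure C(ℝ≥0, ℝ)}
    (h_tight : IsTightMeasureSet {(μ n : Measure C(ℝ≥0, ℝ)) | n})
    (h : ∀ w : ℝ≥0 →₀ ℝ, Tendsto
      (fun n ↦ ∫ x : C(ℝ≥0, ℝ), Complex.exp ((w.sum fun t c ↦ c * x t : ℝ) * Complex.I)
        ∂(μ n : Measure _))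
      atTop (𝓝 (∫ x : C(ℝ≥0, ℝ), Complex.exp ((w.sum fun t c ↦ c * x t : ℝ) * Complex.I)
        ∂(μ₀ : Measure _)))) :
    Tendsto μ atTop (𝓝 μ₀) := by
  -- Combinations only label test functions; the discrete topology makes the joint continuity
  -- required by `charPoly` a statement about each fixed combination.
  let : TopologicalSpace (ℝ≥0 →₀ ℝ) := ⊥
  have : DiscreteTopology (ℝ≥0 →₀ ℝ) := ⟨rfl⟩
  refine ProbabilityMeasure.tendsto_of_tight_of_separatesPoints h_tight (𝕜 := ℂ)
    (A := BoundedContinuousFunction.charPoly Real.continuous_probChar (L := evalPairing)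
      continuous_evalPairing) ?_ fun g hg ↦ ?_
  · refine BoundedContinuousFunction.separatesPoints_charPoly Real.continuous_probChar
      Real.probChar_ne_one _ fun v hv ↦ ?_
    obtain ⟨t, ht⟩ := DFunLike.ne_iff.1 hv
    -- A nonzero path is already detected by a single evaluation.
    refine DFunLike.ne_iff.2 ⟨Finsupp.single t 1, ?_⟩
    rw [evalPairing_apply, Finsupp.sum_single_index (by simp), one_mul]
    exact ht
  · rw [BoundedContinuousFunction.mem_charPoly] at hg
    obtain ⟨w, hw⟩ := hg
    have h_eq (μ : Measure C(ℝ≥0, ℝ)) (hμ : IsProbabilityMeasure μ) :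
        ∫ x, g x ∂μ = w.coeff.sum (fun a z ↦ z * ∫ x,
          Complex.exp ((a.sum fun t c ↦ c * x t : ℝ) * Complex.I) ∂μ) := by
      simp_rw [hw, Finsupp.sum]
      rw [integral_finsetSum]
      · congr with y
        rw [integral_const_mul]
        rfl
      · refine fun i hi ↦ Integrable.const_mul ?_ _
        exact BoundedContinuousFunction.integrable μ
          (BoundedContinuousFunction.char Real.continuous_probChar (L := evalPairing)
            continuous_evalPairing i)
    rw [h_eq μ₀ inferInstance]
    simp_rw [h_eq (μ _) inferInstance]
    exact tendsto_finsetSum _ fun y _ ↦ (h y).const_mul _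

/-- The characteristic function of a finite combination of evaluations of a random path. -/
lemma integral_char_map_path {X : ℝ≥0 → Ω → ℝ} (hX : ∀ t, AEMeasurable (X t) P)
    (hc : ∀ᵐ ω ∂P, Continuous fun t ↦ X t ω) (w : ℝ≥0 →₀ ℝ) :
    ∫ x, Complex.exp ((w.sum fun t c ↦ c * x t : ℝ) * Complex.I) ∂(P.map (path X)) =
      ∫ ω, Complex.exp ((w.sum fun t c ↦ c * X t ω : ℝ) * Complex.I) ∂P := by
  rw [integral_map (aemeasurable_path hX hc)]
  · refine integral_congr_ae ?_
    filter_upwards [hc] with ω hω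
    simp_rw [path_apply hω]
  · refine Continuous.aestronglyMeasurable ?_
    simp only [Finsupp.sum]
    fun_prop

/-- Convergence in distribution in `C[0,∞)` from a fourth moment bound and from convergence of
the characteristic functions of finite combinations of evaluations. -/
theorem tendstoInDistribution_path [IsProbabilityMeasure P] {W : ℕ → ℝ≥0 → Ω → ℝ}
    {Ω' : Type*} [MeasurableSpace Ω'] {Q : Measure Ω'} [IsProbabilityMeasure Q]
    {X : ℝ≥0 → Ω' → ℝ}
    (hm : ∀ n t, AEMeasurable (W n t) P) (hc : ∀ n, ∀ᵐ ω ∂P, Continuous fun t ↦ W n t ω)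
    (h0 : ∀ n, ∀ᵐ ω ∂P, W n 0 ω = 0) {C : ℕ → ℝ} (hC0 : ∀ N, 0 ≤ C N)
    (hC : ∀ (N n : ℕ) (s t : ℝ≥0), s ≤ t → t ≤ N →
      ∫⁻ ω, ‖W n t ω - W n s ω‖ₑ ^ 4 ∂P ≤ ENNReal.ofReal (C N * ((t : ℝ) - s) ^ 2))
    (hXm : ∀ t, AEMeasurable (X t) Q) (hXc : ∀ᵐ ω ∂Q, Continuous fun t ↦ X t ω)
    (h : ∀ w : ℝ≥0 →₀ ℝ, Tendsto
      (fun n ↦ ∫ ω, Complex.exp ((w.sum fun t c ↦ c * W n t ω : ℝ) * Complex.I) ∂P)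
      atTop (𝓝 (∫ ω, Complex.exp ((w.sum fun t c ↦ c * X t ω : ℝ) * Complex.I) ∂Q))) :
    TendstoInDistribution (fun n ↦ path (W n)) atTop (path X) (fun _ ↦ P) Q where
  forall_aemeasurable n := aemeasurable_path (hm n) (hc n)
  aemeasurable_limit := aemeasurable_path hXm hXc
  tendsto := by
    refine tendsto_of_tight_of_tendsto_char ?_ fun w ↦ ?_
    · exact isTightMeasureSet_of_moment hm hc h0 hC0 hC
    · simp only [ProbabilityMeasure.coe_mk]
      rw [integral_char_map_path hXm hXc]
      simp_rw [fun n ↦ integral_char_map_path (hm n) (hc n) w]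
      exact h w

end PathSpace

/-! ### Families of independent Brownian motions -/

section BrownianFamily

variable {Ω : Type*} [MeasurableSpace Ω] {P : Measure Ω} {ι κ : Type*}

/-- A family of independent Brownian motions. -/
structure IsBrownianFamily (X : ι → ℝ≥0 → Ω → ℝ) (P : Measure Ω) : Prop where
  brownian : ∀ i, IsBrownianReal (X i) P
  indep : iIndepFun (fun i ω t ↦ X i t ω) P

namespace IsBrownianFamily

variable {X Y : ι → ℝ≥0 → Ω → ℝ}

lemma isProbabilityMeasure (hX : IsBrownianFamily X P) : IsProbabilityMeasure P :=
  hX.indep.isProbabilityMeasure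

lemma aemeasurable (hX : IsBrownianFamily X P) (i : ι) (t : ℝ≥0) : AEMeasurable (X i t) P :=
  (hX.brownian i).aemeasurable t

lemma comp_injective (hX : IsBrownianFamily X P) {g : κ → ι} (hg : g.Injective) :
    IsBrownianFamily (fun k ↦ X (g k)) P :=
  ⟨fun k ↦ hX.brownian (g k), hX.indep.precomp hg⟩

lemma hasGaussianLaw_eval (hX : IsBrownianFamily X P) (i : ι) (t : ℝ≥0) :
    HasGaussianLaw (X i t) P :=
  have hXi := hX.brownian i
  hXi.isGaussianProcess.hasGaussianLaw_eval t

lemma memLp (hX : IsBrownianFamily X P) (i : ι) (t : ℝ≥0) {q : ENNReal} (hq : q ≠ ⊤) :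
    MemLp (X i t) q P :=
  (hX.hasGaussianLaw_eval i t).memLp hq

/-- A finite set of index pairs sits in a finite rectangle, where joint Gaussianity follows from
independence of the rows; restriction is linear. Afterwards independence can be read off from
covariances. -/
lemma isGaussianProcess (hX : IsBrownianFamily X P) :
    IsGaussianProcess (fun (q : ι × ℝ≥0) ω ↦ X q.1 q.2 ω) P where
  hasGaussianLaw I := by
    classical
    let A := I.image Prod.fst
    let B := I.image Prod.snd
    have h1 : HasGaussianLaw (fun ω (i : A) (t : B) ↦ X i t ω) P := by
      refine iIndepFun.hasGaussianLaw (X := fun (i : A) ω (t : B) ↦ X i t ω) (fun i ↦ ?_) ?_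
      · have hXi := hX.brownian i
        exact hXi.isGaussianProcess.hasGaussianLaw B
      · exact (hX.indep.precomp (Subtype.val_injective (p := (· ∈ A)))).comp
          (fun _ x (t : B) ↦ x t) (fun _ ↦ by fun_prop)
    let L : (A → B → ℝ) →L[ℝ] (I → ℝ) :=
      { toFun x q := x ⟨q.1.1, Finset.mem_image_of_mem _ q.2⟩ ⟨q.1.2, Finset.mem_image_of_mem _ q.2⟩
        map_add' x y := rfl
        map_smul' c x := rfl
        cont := by fun_prop }
    exact h1.map L

lemma covariance [DecidableEq ι] (hX : IsBrownianFamily X P) (i j : ι) (s t : ℝ≥0) :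
    cov[X i s, X j t; P] = if i = j then ((min s t : ℝ≥0) : ℝ) else 0 := by
  have := hX.isProbabilityMeasure
  split_ifs with h
  · subst h
    exact (hX.brownian i).covariance_eval s t
  · refine IndepFun.covariance_eq_zero ?_ (hX.memLp i s (by simp)) (hX.memLp j t (by simp))
    exact (hX.indep.indepFun h).comp (measurable_pi_apply s) (measurable_pi_apply t)

/-- In an uncountable product, a.e. measurability of the coordinates is not enough, as the null sets
depend on `t`. The path space supplies one null set for all times. -/
lemma aemeasurable_process {X : ℝ≥0 → Ω → ℝ} (hX : ∀ t, AEMeasurable (X t) P)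
    (hc : ∀ᵐ ω ∂P, Continuous fun t ↦ X t ω) : AEMeasurable (fun ω t ↦ X t ω) P := by
  have h1 : Measurable fun (g : C(ℝ≥0, ℝ)) t ↦ g t := measurable_pi_lambda _ measurable_eval
  refine (h1.comp_aemeasurable (aemeasurable_path hX hc)).congr ?_
  filter_upwards [hc] with ω hω
  ext t
  exact path_apply hω t

lemma aemeasurable_fun (hX : IsBrownianFamily X P) (i : ι) :
    AEMeasurable (fun ω t ↦ X i t ω) P :=
  aemeasurable_process (hX.aemeasurable i) (hX.brownian i).cont

/-- Used to replace the eigenvalue processes, which change with `n`, by a fixed sequence of Brownian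
motions. -/
lemma identDistrib [Countable ι] (hX : IsBrownianFamily X P) (hY : IsBrownianFamily Y P) :
    IdentDistrib (fun ω i t ↦ X i t ω) (fun ω i t ↦ Y i t ω) P P := by
  have := hX.isProbabilityMeasure
  refine IdentDistrib.pi (fun i ↦ ?_) hX.indep hY.indep
  rw [identDistrib_iff_forall_finset_identDistrib (hX.aemeasurable_fun i) (hY.aemeasurable_fun i)]
  exact fun I ↦ ((hX.brownian i).hasLaw I).identDistrib ((hY.brownian i).hasLaw I)

/-- Orthonormal linear combinations of independent Brownian motions are independent Brownian
motions. -/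
lemma sum_orthonormal [Fintype ι] [DecidableEq κ] (hX : IsBrownianFamily X P) {a : κ → ι → ℝ}
    (ha : ∀ k l, ∑ i, a k i * a l i = if k = l then 1 else 0) :
    IsBrownianFamily (fun k t ω ↦ ∑ i, a k i * X i t ω) P := by
  classical
  have := hX.isProbabilityMeasure
  have hmem : ∀ k i t, MemLp (fun ω ↦ a k i * X i t ω) 2 P :=
    fun k i t ↦ (hX.memLp i t (by simp)).const_mul _
  -- Orthonormality enters only here. The combined process is Gaussian, so this covariance decides
  -- both the Brownian law of each row and the independence of the rows.
  have hcov : ∀ k l s t, cov[fun ω ↦ ∑ i, a k i * X i s ω, fun ω ↦ ∑ i, a l i * X i t ω; P] =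
      if k = l then ((min s t : ℝ≥0) : ℝ) else 0 := by
    intro k l s t
    rw [covariance_fun_sum_fun_sum (fun i ↦ hmem k i s) (fun i ↦ hmem l i t)]
    have h1 : ∀ i j, cov[fun ω ↦ a k i * X i s ω, fun ω ↦ a l j * X j t ω; P] =
        if i = j then a k i * a l j * ((min s t : ℝ≥0) : ℝ) else 0 := by
      intro i j
      rw [covariance_const_mul_left, covariance_const_mul_right, hX.covariance]
      split_ifs <;> ring
    simp_rw [h1, Finset.sum_ite_eq, Finset.mem_univ, if_true, ← Finset.sum_mul, ha]
    split_ifs <;> simp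
  have hgauss : IsGaussianProcess (fun (q : κ × ℝ≥0) ω ↦ ∑ i, a q.1 i * X i q.2 ω) P := by
    refine hX.isGaussianProcess.of_isGaussianProcess fun q ↦ ?_
    refine ⟨Finset.univ.image fun i ↦ (i, q.2),
      { toFun x := ∑ i, a q.1 i *
          x ⟨(i, q.2), Finset.mem_image_of_mem _ (Finset.mem_univ i)⟩
        map_add' x y := by simp [mul_add, Finset.sum_add_distrib]
        map_smul' c x := by simp [Finset.mul_sum, mul_left_comm]
        cont := by fun_prop }, fun ω ↦ rfl⟩
  refine ⟨fun k ↦ ⟨?_, ?_⟩, ?_⟩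
  · refine IsGaussianProcess.isPreBrownianReal_of_covariance (hgauss.comp_right fun t ↦ (k, t))
      (fun t ↦ ?_) fun s t hst ↦ ?_
    · rw [integral_finsetSum _ fun i _ ↦ (hmem k i t).integrable (by simp)]
      refine Finset.sum_eq_zero fun i _ ↦ ?_
      rw [integral_const_mul, (hX.brownian i).integral_eval, mul_zero]
    · rw [hcov, if_pos rfl, min_eq_left hst]
  · have : ∀ᵐ ω ∂P, ∀ i, Continuous fun t ↦ X i t ω := ae_all_iff.2 fun i ↦ (hX.brownian i).cont
    filter_upwards [this] with ω hω
    fun_prop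
  · refine IsGaussianProcess.iIndepFun_of_covariance_eq_zero
      (X := fun k t ω ↦ ∑ i, a k i * X i t ω)
      (hgauss.comp_right fun q : (_ : κ) × ℝ≥0 ↦ (q.1, q.2)) (fun k t ↦ ?_)
      fun k l hkl s t ↦ ?_
    · exact Finset.aemeasurable_fun_sum _ fun i _ ↦ (hX.aemeasurable i t).const_mul _
    · rw [hcov, if_neg hkl]

/-- Grouping a family of independent Brownian motions into blocks gives independent blocks. -/
lemma indep_blocks {X : κ × ι → ℝ≥0 → Ω → ℝ} (hX : IsBrownianFamily X P) :
    iIndepFun (fun k ω (q : ι × ℝ≥0) ↦ X (k, q.1) q.2 ω) P := by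
  classical
  refine IsGaussianProcess.iIndepFun_of_covariance_eq_zero
    (X := fun k (q : ι × ℝ≥0) ω ↦ X (k, q.1) q.2 ω) ?_ (fun k q ↦ hX.aemeasurable _ _)
    fun k l hkl q q' ↦ ?_
  · exact hX.isGaussianProcess.comp_right
      fun q : (_ : κ) × (ι × ℝ≥0) ↦ ((q.1, q.2.1), q.2.2)
  · rw [hX.covariance, if_neg (by simp [hkl])]

/-- The increments after time `s` are independent of the values at time `s`. -/
lemma indepFun_increment [Fintype ι] (hX : IsBrownianFamily X P) {s t : ℝ≥0} (hst : s ≤ t) :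
    IndepFun (fun ω i ↦ X i s ω) (fun ω i ↦ X i t ω - X i s ω) P := by
  classical
  have := hX.isProbabilityMeasure
  refine HasGaussianLaw.indepFun_of_covariance_eval (X := fun i ω ↦ X i s ω)
    (Y := fun i ω ↦ X i t ω - X i s ω) ?_ fun i j ↦ ?_
  · let I : Finset (ι × ℝ≥0) := Finset.univ ×ˢ {s, t}
    have hs : ∀ i, (i, s) ∈ I := fun i ↦ by simp [I]
    have ht : ∀ i, (i, t) ∈ I := fun i ↦ by simp [I]
    let L : (I → ℝ) →L[ℝ] (ι → ℝ) × (ι → ℝ) :=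
      { toFun x := (fun i ↦ x ⟨(i, s), hs i⟩, fun i ↦ x ⟨(i, t), ht i⟩ - x ⟨(i, s), hs i⟩)
        map_add' x y := by ext <;> simp; ring
        map_smul' c x := by ext <;> simp; ring
        cont := by fun_prop }
    exact (hX.isGaussianProcess.hasGaussianLaw I).map L
  · rw [covariance_fun_sub_right (hX.memLp i s (by simp)) (hX.memLp j t (by simp))
      (hX.memLp j s (by simp)), hX.covariance, hX.covariance, min_eq_left hst, min_self, sub_self]

end IsBrownianFamily

end BrownianFamily

/-! ### Random variables with finite moments -/

section Moments

variable {Ω : Type*} [MeasurableSpace Ω] {P : Measure Ω} {𝕜 : Type*} [RCLike 𝕜]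

/-- The random variable `f` has finite moments of all orders. -/
def HasMoments (f : Ω → 𝕜) (P : Measure Ω) : Prop := ∀ q : ℕ, MemLp f q P

namespace HasMoments

variable {f g : Ω → 𝕜}

lemma aestronglyMeasurable (hf : HasMoments f P) : AEStronglyMeasurable f P :=
  (hf 0).aestronglyMeasurable

lemma integrable (hf : HasMoments f P) : Integrable f P :=
  memLp_one_iff_integrable.1 (by simpa using hf 1)

lemma const [IsFiniteMeasure P] (c : 𝕜) : HasMoments (fun _ : Ω ↦ c) P := fun _ ↦ memLp_const c

lemma add (hf : HasMoments f P) (hg : HasMoments g P) : HasMoments (fun ω ↦ f ω + g ω) P :=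
  fun q ↦ (hf q).add (hg q)

lemma sub (hf : HasMoments f P) (hg : HasMoments g P) : HasMoments (fun ω ↦ f ω - g ω) P :=
  fun q ↦ (hf q).sub (hg q)

lemma const_mul (hf : HasMoments f P) (c : 𝕜) : HasMoments (fun ω ↦ c * f ω) P :=
  fun q ↦ (hf q).const_mul c

lemma mul (hf : HasMoments f P) (hg : HasMoments g P) : HasMoments (fun ω ↦ f ω * g ω) P := by
  intro q
  -- Hölder with `1/q = 1/(2q) + 1/(2q)`; requiring moments of all orders makes the class closed
  -- under products.
  have : ENNReal.HolderTriple ((2 * q : ℕ) : ENNReal) ((2 * q : ℕ) : ENNReal) (q : ENNReal) := by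
    constructor
    push_cast
    rw [ENNReal.mul_inv (by simp) (by simp), ← add_mul, ENNReal.inv_two_add_inv_two, one_mul]
  exact (hg (2 * q)).mul' (hf (2 * q))

lemma pow [IsFiniteMeasure P] (hf : HasMoments f P) (n : ℕ) : HasMoments (fun ω ↦ f ω ^ n) P := by
  induction n with
  | zero => simpa using const (1 : 𝕜)
  | succ n ih =>
    simp_rw [pow_succ]
    exact ih.mul hf

lemma sum {ι : Type*} {s : Finset ι} {F : ι → Ω → 𝕜} (hF : ∀ i ∈ s, HasMoments (F i) P) :
    HasMoments (fun ω ↦ ∑ i ∈ s, F i ω) P := fun q ↦ memLp_finsetSum s fun i hi ↦ hF i hi q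

lemma norm (hf : HasMoments f P) : HasMoments (fun ω ↦ ‖f ω‖) P := fun q ↦ (hf q).norm

lemma re {f : Ω → ℂ} (hf : HasMoments f P) : HasMoments (fun ω ↦ (f ω).re) P := fun q ↦ (hf q).re

lemma ofReal {f : Ω → ℝ} (hf : HasMoments f P) : HasMoments (fun ω ↦ (f ω : ℂ)) P :=
  fun q ↦ (hf q).ofReal

lemma conj {f : Ω → ℂ} (hf : HasMoments f P) :
    HasMoments (fun ω ↦ (starRingEnd ℂ) (f ω)) P := fun q ↦ (hf q).star

end HasMoments

end Moments

/-! ### Moments of Brownian motion -/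

section BrownianMoments

variable {Ω : Type*} [MeasurableSpace Ω] {P : Measure Ω}

/-- Folding onto the half line gives a Gamma integral at `p + 1/2`. For `p = 0` the truncated
subtraction yields `0‼ = 1`, as needed. -/
lemma integral_pow_gaussianReal_zero_one (p : ℕ) :
    ∫ x, x ^ (2 * p) ∂gaussianReal 0 1 = ((2 * p - 1)‼ : ℕ) := by
  rw [integral_gaussianReal_eq_integral_smul one_ne_zero]
  simp only [gaussianPDFReal, smul_eq_mul, NNReal.coe_one, mul_one, sub_zero, mul_assoc]
  rw [integral_const_mul]
  have h1 : ∀ x : ℝ, Real.exp (-x ^ 2 / 2) * x ^ (2 * p) =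
      |x| ^ (2 * p) * Real.exp (-(1 / 2) * |x| ^ 2) := by
    intro x
    rw [sq_abs, pow_mul |x|, sq_abs, ← pow_mul, mul_comm]
    ring_nf
  simp_rw [h1]
  rw [integral_comp_abs (f := fun x ↦ x ^ (2 * p) * Real.exp (-(1 / 2) * x ^ 2))]
  have h2 := integral_rpow_mul_exp_neg_mul_rpow (p := 2) (q := 2 * p) (b := 1 / 2) two_pos
    (by linarith [(Nat.cast_nonneg p : (0 : ℝ) ≤ p)]) (by norm_num)
  have h3 : ∫ x in Set.Ioi (0 : ℝ), x ^ (2 * p) * Real.exp (-(1 / 2) * x ^ 2) =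
      ∫ x in Set.Ioi (0 : ℝ), x ^ (2 * p : ℝ) * Real.exp (-(1 / 2) * x ^ (2 : ℝ)) := by
    refine integral_congr_ae (Eventually.of_forall fun x ↦ ?_)
    simp only [Real.rpow_two]
    congr 1
    rw [← Real.rpow_natCast]
    push_cast
    rfl
  have h4 : (2 * (p : ℝ) + 1) / 2 = p + 1 / 2 := by ring
  have h5 : (2 : ℝ) ^ (2⁻¹ : ℝ) = √2 := by rw [Real.sqrt_eq_rpow, one_div]
  rw [h3, h2, neg_div, h4, Real.Gamma_nat_add_half, Real.rpow_neg (by norm_num), one_div,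
    Real.inv_rpow (by norm_num), inv_inv, Real.rpow_add (by norm_num), Real.rpow_natCast,
    h5, Real.sqrt_mul (by norm_num)]
  field_simp

/-- Brownian scaling of the moments. -/
lemma integral_pow_eq_sqrt_pow_mul {X : ℝ≥0 → Ω → ℝ} (hX : IsBrownianReal X P) (t : ℝ≥0) (p : ℕ) :
    ∫ ω, X t ω ^ p ∂P = √(t : ℝ) ^ p * ∫ x, x ^ p ∂gaussianReal 0 1 := by
  have h1 : (gaussianReal 0 1).map (fun x ↦ √(t : ℝ) * x) = gaussianReal 0 t := by
    rw [gaussianReal_map_const_mul, mul_zero, mul_one]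
    congr 1
    ext
    simp
  have h2 : ∫ ω, X t ω ^ p ∂P = ∫ x, x ^ p ∂gaussianReal 0 t := by
    rw [← (hX.hasLaw_eval t).map_eq, integral_map (hX.aemeasurable t) (by fun_prop)]
  rw [h2, ← h1, integral_map (by fun_prop) (by fun_prop)]
  simp_rw [mul_pow]
  rw [integral_const_mul]

/-- The even moments of Brownian motion. -/
lemma integral_pow_of_isBrownianReal {X : ℝ≥0 → Ω → ℝ} (hX : IsBrownianReal X P) (t : ℝ≥0)
    (p : ℕ) : ∫ ω, X t ω ^ (2 * p) ∂P = ((2 * p - 1)‼ : ℕ) * (t : ℝ) ^ p := by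
  rw [integral_pow_eq_sqrt_pow_mul hX, integral_pow_gaussianReal_zero_one, pow_mul,
    Real.sq_sqrt (NNReal.coe_nonneg t), mul_comm]

/-- The linear combination `α X + β Y` of two real processes. -/
def complexComb (α β : ℂ) (X Y : ℝ≥0 → Ω → ℝ) (t : ℝ≥0) (ω : Ω) : ℂ := α * X t ω + β * Y t ω

/-- Only `‖α‖, ‖β‖ ≤ 1` matters, so the same estimates serve complex Brownian motion and, with `α =
1`, `β = 0`, the real eigenvalues. -/
lemma norm_complexComb_pow_le {α β : ℂ} (hα : ‖α‖ ≤ 1) (hβ : ‖β‖ ≤ 1) (x y : ℝ) (k : ℕ) :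
    ‖α * x + β * y‖ ^ (2 * k) ≤ 2 ^ (2 * k) * (x ^ (2 * k) + y ^ (2 * k)) := by
  have h1 : ‖α * x + β * y‖ ≤ |x| + |y| := by
    refine (norm_add_le _ _).trans ?_
    rw [norm_mul, norm_mul, Complex.norm_real, Complex.norm_real, Real.norm_eq_abs,
      Real.norm_eq_abs]
    gcongr <;> exact mul_le_of_le_one_left (abs_nonneg _) ‹_›
  have h2 : ∀ z : ℝ, |z| ^ (2 * k) = z ^ (2 * k) := fun z ↦ by rw [pow_mul, sq_abs, ← pow_mul]
  calc ‖α * x + β * y‖ ^ (2 * k) ≤ (|x| + |y|) ^ (2 * k) := by gcongr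
    _ ≤ 2 ^ (2 * k - 1) * (|x| ^ (2 * k) + |y| ^ (2 * k)) :=
        add_pow_le (abs_nonneg _) (abs_nonneg _) _
    _ ≤ 2 ^ (2 * k) * (|x| ^ (2 * k) + |y| ^ (2 * k)) := by
        gcongr
        · norm_num
        · omega
    _ = _ := by rw [h2, h2]

lemma IsBrownianReal.hasMoments {X : ℝ≥0 → Ω → ℝ} (hX : IsBrownianReal X P) (t : ℝ≥0) :
    HasMoments (X t) P := fun _ ↦ (hX.isGaussianProcess.hasGaussianLaw_eval t).memLp (by simp)

lemma hasMoments_complexComb {X Y : ℝ≥0 → Ω → ℝ} (hX : IsBrownianReal X P)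
    (hY : IsBrownianReal Y P) (α β : ℂ) (t : ℝ≥0) : HasMoments (complexComb α β X Y t) P :=
  ((IsBrownianReal.hasMoments hX t).ofReal.const_mul α).add
    ((IsBrownianReal.hasMoments hY t).ofReal.const_mul β)

lemma integral_norm_complexComb_pow_le {α β : ℂ} (hα : ‖α‖ ≤ 1) (hβ : ‖β‖ ≤ 1)
    {X Y : ℝ≥0 → Ω → ℝ} (hX : IsBrownianReal X P) (hY : IsBrownianReal Y P) (t : ℝ≥0) (k : ℕ) :
    ∫ ω, ‖complexComb α β X Y t ω‖ ^ (2 * k) ∂P ≤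
      2 ^ (2 * k + 1) * ((2 * k - 1)‼ : ℕ) * (t : ℝ) ^ k := by
  have := hX.isGaussianProcess.isProbabilityMeasure
  have hXi := ((IsBrownianReal.hasMoments hX t).pow (2 * k)).integrable
  have hYi := ((IsBrownianReal.hasMoments hY t).pow (2 * k)).integrable
  calc ∫ ω, ‖complexComb α β X Y t ω‖ ^ (2 * k) ∂P
      ≤ ∫ ω, 2 ^ (2 * k) * (X t ω ^ (2 * k) + Y t ω ^ (2 * k)) ∂P := by
        refine integral_mono ?_ ((hXi.add hYi).const_mul _) fun ω ↦ ?_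
        · exact ((hasMoments_complexComb hX hY α β t).norm.pow _).integrable
        · exact norm_complexComb_pow_le hα hβ _ _ _
    _ = _ := by
        rw [integral_const_mul, integral_add hXi hYi, integral_pow_of_isBrownianReal hX,
          integral_pow_of_isBrownianReal hY]
        ring

/-- The increment after `s` is the same combination of the Brownian motions restarted at `s`, run
for time `t - s`. -/
lemma integral_norm_complexComb_sub_pow_le {α β : ℂ} (hα : ‖α‖ ≤ 1) (hβ : ‖β‖ ≤ 1)
    {X Y : ℝ≥0 → Ω → ℝ} (hX : IsBrownianReal X P) (hY : IsBrownianReal Y P) {s t : ℝ≥0}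
    (hst : s ≤ t) (k : ℕ) :
    ∫ ω, ‖complexComb α β X Y t ω - complexComb α β X Y s ω‖ ^ (2 * k) ∂P ≤
      2 ^ (2 * k + 1) * ((2 * k - 1)‼ : ℕ) * ((t : ℝ) - s) ^ k := by
  have h := integral_norm_complexComb_pow_le hα hβ (hX.shift s) (hY.shift s) (t - s) k
  rw [NNReal.coe_sub hst] at h
  refine le_of_eq_of_le ?_ h
  congr with ω
  simp only [complexComb, add_tsub_cancel_of_le hst]
  push_cast
  ring_nf

lemma norm_pow_sub_pow_le' (a b : ℂ) (p : ℕ) :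
    ‖a ^ p - b ^ p‖ ≤ ‖a - b‖ * (p * (‖a‖ + ‖b‖) ^ (p - 1)) := by
  rw [← (Commute.all a b).mul_geom_sum₂, norm_mul]
  gcongr
  refine (norm_sum_le _ _).trans ?_
  calc ∑ i ∈ Finset.range p, ‖a ^ i * b ^ (p - 1 - i)‖
      ≤ ∑ i ∈ Finset.range p, (‖a‖ + ‖b‖) ^ (p - 1) := by
        refine Finset.sum_le_sum fun i hi ↦ ?_
        have hi' : i ≤ p - 1 := by have := Finset.mem_range.1 hi; omega
        rw [norm_mul, norm_pow, norm_pow]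
        calc ‖a‖ ^ i * ‖b‖ ^ (p - 1 - i)
            ≤ (‖a‖ + ‖b‖) ^ i * (‖a‖ + ‖b‖) ^ (p - 1 - i) := by
              gcongr
              · exact le_add_of_nonneg_right (norm_nonneg _)
              · exact le_add_of_nonneg_left (norm_nonneg _)
          _ = _ := by rw [← pow_add, Nat.add_sub_cancel' hi']
    _ = _ := by simp

/-- A bound for the fourth moments of the increments of the powers of `α X + β Y`. -/
lemma exists_integral_norm_pow_sub_pow_le (p : ℕ) (T : ℝ≥0) : ∃ C : ℝ, 0 ≤ C ∧
    ∀ {α β : ℂ}, ‖α‖ ≤ 1 → ‖β‖ ≤ 1 → ∀ {X Y : ℝ≥0 → Ω → ℝ}, IsBrownianReal X P →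
    IsBrownianReal Y P → ∀ {s t : ℝ≥0}, s ≤ t → t ≤ T →
    ∫ ω, ‖complexComb α β X Y t ω ^ p - complexComb α β X Y s ω ^ p‖ ^ 4 ∂P ≤
      C * ((t : ℝ) - s) ^ 2 := by
  -- The factor `(|a| + |b|)^(p-1)` ends up raised to the eighth power, and `8 (p - 1) = 2 k`.
  let k := 4 * (p - 1)
  let A : ℝ := 2 ^ (2 * 4 + 1) * ((2 * 4 - 1)‼ : ℕ)
  let B : ℝ := 2 ^ (2 * k + 1) * ((2 * k - 1)‼ : ℕ) * (T : ℝ) ^ k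
  refine ⟨A + p ^ 8 * (2 ^ (2 * k) * (B + B)), by positivity, ?_⟩
  intro α β hα hβ X Y hX hY s t hst htT
  have := hX.isGaussianProcess.isProbabilityMeasure
  have hm := fun u ↦ hasMoments_complexComb hX hY α β u
  let D : Ω → ℝ := fun ω ↦ ‖complexComb α β X Y t ω - complexComb α β X Y s ω‖
  let a : Ω → ℝ := fun ω ↦ ‖complexComb α β X Y t ω‖
  let b : Ω → ℝ := fun ω ↦ ‖complexComb α β X Y s ω‖
  rcases hst.eq_or_lt with rfl | hlt
  · simp
  have hh : 0 < (t : ℝ) - s := sub_pos.2 (by exact_mod_cast hlt)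
  set h : ℝ := (t : ℝ) - s with hdef
  have hDi : Integrable (fun ω ↦ D ω ^ (2 * 4)) P := (((hm t).sub (hm s)).norm.pow _).integrable
  have hai : Integrable (fun ω ↦ a ω ^ (2 * k)) P := ((hm t).norm.pow _).integrable
  have hbi : Integrable (fun ω ↦ b ω ^ (2 * k)) P := ((hm s).norm.pow _).integrable
  have hEi : Integrable (fun ω ↦ h ^ 2 * (p ^ 8 * (2 ^ (2 * k) *
      (a ω ^ (2 * k) + b ω ^ (2 * k))))) P :=
    (((hai.add hbi).const_mul _).const_mul _).const_mul _
  have hpt : ∀ ω, ‖complexComb α β X Y t ω ^ p - complexComb α β X Y s ω ^ p‖ ^ 4 ≤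
      (h ^ 2)⁻¹ * D ω ^ (2 * 4) +
        h ^ 2 * (p ^ 8 * (2 ^ (2 * k) * (a ω ^ (2 * k) + b ω ^ (2 * k)))) := by
    intro ω
    have ha : 0 ≤ a ω := norm_nonneg _
    have hb : 0 ≤ b ω := norm_nonneg _
    have hD : 0 ≤ D ω := norm_nonneg _
    have h1 : (a ω + b ω) ^ (2 * k) ≤ 2 ^ (2 * k) * (a ω ^ (2 * k) + b ω ^ (2 * k)) := by
      refine (add_pow_le ha hb _).trans ?_
      gcongr
      · norm_num
      · omega
    let u := D ω ^ 4
    let v := (p * (a ω + b ω) ^ (p - 1)) ^ 4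
    -- Weighted arithmetic–geometric mean in place of Cauchy–Schwarz. Since `E D⁸` is of order `h⁴`,
    -- the weights `h⁻²` and `h²` make both terms of order `h²`.
    have h2 : u * v ≤ (h ^ 2)⁻¹ * u ^ 2 + h ^ 2 * v ^ 2 := by
      have h3 : 0 ≤ u * v := by positivity
      have h4 : 0 ≤ (h⁻¹ * u - h * v) ^ 2 := sq_nonneg _
      have h5 : (h⁻¹ * u - h * v) ^ 2 = (h ^ 2)⁻¹ * u ^ 2 + h ^ 2 * v ^ 2 - 2 * (u * v) := by
        field_simp
        ring
      linarith
    calc _ ≤ (D ω * (p * (a ω + b ω) ^ (p - 1))) ^ 4 := by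
          gcongr
          exact norm_pow_sub_pow_le' _ _ _
      _ = u * v := by simp only [u, v]; ring
      _ ≤ _ := h2
      _ = (h ^ 2)⁻¹ * D ω ^ (2 * 4) + h ^ 2 * (p ^ 8 * (a ω + b ω) ^ (2 * k)) := by
          simp only [u, v, k]
          ring_nf
      _ ≤ _ := by gcongr
  have hb' : ∀ u : ℝ≥0, u ≤ T → ∫ ω, ‖complexComb α β X Y u ω‖ ^ (2 * k) ∂P ≤ B := by
    intro u hu
    refine (integral_norm_complexComb_pow_le hα hβ hX hY u k).trans ?_
    simp only [B]
    gcongr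
  calc ∫ ω, ‖complexComb α β X Y t ω ^ p - complexComb α β X Y s ω ^ p‖ ^ 4 ∂P
      ≤ ∫ ω, ((h ^ 2)⁻¹ * D ω ^ (2 * 4) +
        h ^ 2 * (p ^ 8 * (2 ^ (2 * k) * (a ω ^ (2 * k) + b ω ^ (2 * k))))) ∂P := by
        refine integral_mono ?_ ?_ hpt
        · exact ((((hm t).pow p).sub ((hm s).pow p)).norm.pow 4).integrable
        · exact (hDi.const_mul _).add hEi
    _ = (h ^ 2)⁻¹ * ∫ ω, D ω ^ (2 * 4) ∂P + h ^ 2 * (p ^ 8 * (2 ^ (2 * k) *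
        (∫ ω, a ω ^ (2 * k) ∂P + ∫ ω, b ω ^ (2 * k) ∂P))) := by
        rw [integral_add (hDi.const_mul _) hEi]
        simp_rw [integral_const_mul]
        rw [integral_add hai hbi]
    _ ≤ (h ^ 2)⁻¹ * (A * h ^ 4) + h ^ 2 * (p ^ 8 * (2 ^ (2 * k) * (B + B))) := by
        gcongr
        · exact integral_norm_complexComb_sub_pow_le hα hβ hX hY hst 4
        · exact hb' t htT
        · exact hb' s (hst.trans htT)
    _ = _ := by
        field_simp

end BrownianMoments

/-! ### Moments of complex Brownian motion -/

section ComplexBrownian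

variable {Ω : Type*} [MeasurableSpace Ω] {P : Measure Ω} {X : Fin 2 → ℝ≥0 → Ω → ℝ}

/-- The standard complex Brownian motion, with `E|Z(t)|² = t`. -/
noncomputable def complexBM (X : Fin 2 → ℝ≥0 → Ω → ℝ) (t : ℝ≥0) (ω : Ω) : ℂ :=
  complexComb ((√2 : ℝ)⁻¹ : ℝ) ((√2 : ℝ)⁻¹ * Complex.I) (X 0) (X 1) t ω

lemma hasMoments_complexBM (hX : IsBrownianFamily X P) (t : ℝ≥0) : HasMoments (complexBM X t) P :=
  hasMoments_complexComb (hX.brownian 0) (hX.brownian 1) _ _ t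

/-- Complex Brownian motion is invariant in law under rotations. -/
lemma integral_rotate_complexBM (hX : IsBrownianFamily X P) {u : ℂ} (hu : ‖u‖ = 1)
    {G : (ℝ≥0 → ℂ) → ℂ} (hG : Measurable G) :
    ∫ ω, G (fun t ↦ u * complexBM X t ω) ∂P = ∫ ω, G (fun t ↦ complexBM X t ω) ∂P := by
  -- Multiplication by `u` is a rotation of the plane, hence an orthonormal transformation of the
  -- two real coordinates.
  let a : Fin 2 → Fin 2 → ℝ := ![![u.re, -u.im], ![u.im, u.re]]
  have hu' : u.re * u.re + u.im * u.im = 1 := by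
    rw [← Complex.normSq_apply, Complex.normSq_eq_norm_sq, hu, one_pow]
  have hX' : IsBrownianFamily (fun k t ω ↦ ∑ i, a k i * X i t ω) P := by
    refine hX.sum_orthonormal fun k l ↦ ?_
    fin_cases k <;> fin_cases l <;> simp [a, Fin.sum_univ_two] <;> linarith
  have hrot : ∀ t ω, complexBM (fun k t ω ↦ ∑ i, a k i * X i t ω) t ω = u * complexBM X t ω := by
    intro t ω
    have h1 := Complex.re_add_im u
    have h2 := Complex.I_sq
    simp only [complexBM, complexComb, Fin.sum_univ_two, a]
    simp
    linear_combination ((√2 : ℂ)⁻¹ * X 0 t ω + (√2 : ℂ)⁻¹ * Complex.I * X 1 t ω) * h1 -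
      (√2 : ℂ)⁻¹ * u.im * X 1 t ω * h2
  let Φ : (Fin 2 → ℝ≥0 → ℝ) → ℝ≥0 → ℂ := fun x t ↦
    (((√2 : ℝ)⁻¹ : ℝ) : ℂ) * x 0 t + ((√2 : ℝ)⁻¹ * Complex.I) * x 1 t
  have hΦ : Measurable Φ := by fun_prop
  have h := ((hX'.identDistrib hX).comp (hG.comp hΦ)).integral_eq
  simp_rw [← hrot]
  exact h

/-- A functional of complex Brownian motion which rotations multiply by a nontrivial character
has mean zero. -/
lemma integral_complexBM_eq_zero (hX : IsBrownianFamily X P) {G : (ℝ≥0 → ℂ) → ℂ}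
    (hG : Measurable G) {m : ℤ} (hm : m ≠ 0)
    (h : ∀ (u : ℂ) (z : ℝ≥0 → ℂ), ‖u‖ = 1 → G (fun t ↦ u * z t) = u ^ m * G z) :
    ∫ ω, G (fun t ↦ complexBM X t ω) ∂P = 0 := by
  -- An angle with `u ^ m = -1`, so that rotation invariance says the mean equals its negative.
  let u : ℂ := Complex.exp (((Real.pi / m : ℝ) : ℂ) * Complex.I)
  have hu : ‖u‖ = 1 := Complex.norm_exp_ofReal_mul_I _
  have hum : u ^ m = -1 := by
    rw [← Complex.exp_int_mul]
    have : (m : ℂ) * (((Real.pi / m : ℝ) : ℂ) * Complex.I) = Real.pi * Complex.I := by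
      have : (m : ℂ) ≠ 0 := by exact_mod_cast hm
      push_cast
      field_simp
    rw [this, Complex.exp_pi_mul_I]
  have h1 := integral_rotate_complexBM hX hu hG
  simp_rw [fun z ↦ h u z hu, hum, neg_one_mul, integral_neg] at h1
  exact self_eq_neg.1 h1.symm

lemma conj_eq_inv_of_norm_eq_one {u : ℂ} (hu : ‖u‖ = 1) : (starRingEnd ℂ) u = u⁻¹ := by
  rw [Complex.inv_def, Complex.normSq_eq_norm_sq, hu]
  simp

lemma measurable_conj_eval (t : ℝ≥0) :
    Measurable fun z : ℝ≥0 → ℂ ↦ (starRingEnd ℂ) (z t) :=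
  Complex.continuous_conj.measurable.comp (measurable_pi_apply t)

/-- Mixed moments of different degrees vanish. -/
lemma integral_pow_mul_conj_pow_eq_zero (hX : IsBrownianFamily X P) (s t : ℝ≥0) {j k : ℕ}
    (hjk : j ≠ k) :
    ∫ ω, complexBM X s ω ^ j * (starRingEnd ℂ) (complexBM X t ω) ^ k ∂P = 0 := by
  refine integral_complexBM_eq_zero hX (G := fun z ↦ z s ^ j * (starRingEnd ℂ) (z t) ^ k)
    ?_ (m := (j : ℤ) - k) (sub_ne_zero.2 (by exact_mod_cast hjk)) fun u z hu ↦ ?_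
  · exact ((measurable_pi_apply s).pow_const j).mul ((measurable_conj_eval t).pow_const k)
  · have hu0 : u ≠ 0 := fun h ↦ by simp [h] at hu
    rw [map_mul, conj_eq_inv_of_norm_eq_one hu, zpow_sub₀ hu0, zpow_natCast, zpow_natCast, mul_pow,
      mul_pow, inv_pow]
    field_simp

lemma integral_pow_mul_pow_eq_zero (hX : IsBrownianFamily X P) (s t : ℝ≥0) {j k : ℕ}
    (hj : j ≠ 0) :
    ∫ ω, complexBM X s ω ^ j * complexBM X t ω ^ k ∂P = 0 := by
  refine integral_complexBM_eq_zero hX (G := fun z ↦ z s ^ j * z t ^ k)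
    ?_ (m := (j : ℤ) + k) (by omega) fun u z hu ↦ ?_
  · exact ((measurable_pi_apply s).pow_const j).mul ((measurable_pi_apply t).pow_const k)
  · have hu0 : u ≠ 0 := fun h ↦ by simp [h] at hu
    rw [zpow_add₀ hu0, zpow_natCast, zpow_natCast]
    ring

lemma integral_conj_sub_pow_eq_zero (hX : IsBrownianFamily X P) (s t : ℝ≥0) {k : ℕ}
    (hk : k ≠ 0) :
    ∫ ω, (starRingEnd ℂ) (complexBM X t ω - complexBM X s ω) ^ k ∂P = 0 := by
  refine integral_complexBM_eq_zero hX (G := fun z ↦ (starRingEnd ℂ) (z t - z s) ^ k)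
    ?_ (m := -(k : ℤ)) (by omega) fun u z hu ↦ ?_
  · simp_rw [map_sub]
    exact ((measurable_conj_eval t).sub (measurable_conj_eval s)).pow_const k
  · rw [← mul_sub, map_mul, conj_eq_inv_of_norm_eq_one hu, mul_pow, zpow_neg, zpow_natCast, inv_pow]

lemma factorial_two_mul_eq (p : ℕ) : (2 * p)! = (2 * p - 1)‼ * 2 ^ p * p ! := by
  rcases p with _ | p
  · simp
  · rw [show 2 * (p + 1) = (2 * p + 1) + 1 by ring, Nat.factorial_eq_mul_doubleFactorial,
      show 2 * p + 1 + 1 = 2 * (p + 1) by ring, Nat.doubleFactorial_two_mul]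
    simp only [show 2 * (p + 1) - 1 = 2 * p + 1 by omega]
    ring

/-- The absolute moments of complex Brownian motion. -/
lemma integral_pow_mul_conj_pow_self (hX : IsBrownianFamily X P) (t : ℝ≥0) (p : ℕ) :
    ∫ ω, complexBM X t ω ^ p * (starRingEnd ℂ) (complexBM X t ω) ^ p ∂P =
      (p ! : ℂ) * (t : ℂ) ^ p := by
  have := hX.isProbabilityMeasure
  have hm := hasMoments_complexBM hX t
  -- `Z + conj Z = √2 X₀` has known even moments. In the binomial expansion of its `2p`-th power
  -- only the middle term has nonzero mean, and this determines `E |Z|^(2p)`.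
  have h1 : ∀ ω, (complexBM X t ω + (starRingEnd ℂ) (complexBM X t ω)) ^ (2 * p) =
      ((2 ^ p * X 0 t ω ^ (2 * p) : ℝ) : ℂ) := by
    intro ω
    have : complexBM X t ω + (starRingEnd ℂ) (complexBM X t ω) = ((√2 * X 0 t ω : ℝ) : ℂ) := by
      rw [Complex.add_conj]
      simp [complexBM, complexComb]
      ring
    rw [this, ← Complex.ofReal_pow, mul_pow, pow_mul (√2), Real.sq_sqrt (by norm_num)]
  have h2 : ∫ ω, (complexBM X t ω + (starRingEnd ℂ) (complexBM X t ω)) ^ (2 * p) ∂P =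
      ((2 ^ p * (((2 * p - 1)‼ : ℕ) * (t : ℝ) ^ p) : ℝ) : ℂ) := by
    simp_rw [h1]
    rw [integral_complex_ofReal, integral_const_mul, integral_pow_of_isBrownianReal (hX.brownian 0)]
  simp_rw [add_pow] at h2
  rw [integral_finsetSum _ fun j _ ↦ ?_, Finset.sum_eq_single p] at h2
  · rw [integral_mul_const, show 2 * p - p = p by omega] at h2
    have h3 : ((2 * p).choose p * p ! * p ! : ℕ) = (2 * p - 1)‼ * 2 ^ p * p ! := by
      rw [← factorial_two_mul_eq,
        ← Nat.choose_mul_factorial_mul_factorial (show p ≤ 2 * p by omega),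
        show 2 * p - p = p by omega]
    have h3' : ((2 * p).choose p : ℂ) * p ! = ((2 * p - 1)‼ : ℕ) * 2 ^ p := by
      have hp : (p ! : ℂ) ≠ 0 := by exact_mod_cast p.factorial_ne_zero
      apply mul_right_cancel₀ hp
      exact_mod_cast h3
    have hc : ((2 * p).choose p : ℂ) ≠ 0 := by
      exact_mod_cast (Nat.choose_pos (by omega)).ne'
    apply mul_right_cancel₀ hc
    rw [h2]
    push_cast
    linear_combination (-(t : ℂ) ^ p) * h3'
  · intro j hj hjp
    rw [integral_mul_const, integral_pow_mul_conj_pow_eq_zero hX, zero_mul]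
    have := Finset.mem_range.1 hj
    omega
  · intro h
    exact absurd (Finset.mem_range.2 (by omega)) h
  · exact (((hm.pow j).mul (hm.conj.pow _)).mul (HasMoments.const _)).integrable

/-- Split `conj Z(t)` into its value at `s` and an independent increment. Positive powers of the
increment have mean zero, so only the term without it survives. -/
lemma integral_pow_mul_conj_pow_of_le (hX : IsBrownianFamily X P) {s t : ℝ≥0} (hst : s ≤ t)
    (p : ℕ) :
    ∫ ω, complexBM X s ω ^ p * (starRingEnd ℂ) (complexBM X t ω) ^ p ∂P =
      (p ! : ℂ) * (s : ℂ) ^ p := by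
  have := hX.isProbabilityMeasure
  have hm := fun u ↦ hasMoments_complexBM hX u
  have hW : HasMoments (fun ω ↦ complexBM X t ω - complexBM X s ω) P := (hm t).sub (hm s)
  have h1 : ∀ ω, complexBM X s ω ^ p * (starRingEnd ℂ) (complexBM X t ω) ^ p =
      ∑ j ∈ Finset.range (p + 1), (complexBM X s ω ^ p * (starRingEnd ℂ) (complexBM X s ω) ^ j *
        (starRingEnd ℂ) (complexBM X t ω - complexBM X s ω) ^ (p - j)) * (p.choose j : ℂ) := by
    intro ω
    have : (starRingEnd ℂ) (complexBM X t ω) = (starRingEnd ℂ) (complexBM X s ω) +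
        (starRingEnd ℂ) (complexBM X t ω - complexBM X s ω) := by
      rw [← map_add, add_sub_cancel]
    rw [this, add_pow, Finset.mul_sum]
    refine Finset.sum_congr rfl fun j _ ↦ ?_
    ring
  have hind : ∀ j, ∫ ω, complexBM X s ω ^ p * (starRingEnd ℂ) (complexBM X s ω) ^ j *
        (starRingEnd ℂ) (complexBM X t ω - complexBM X s ω) ^ (p - j) ∂P =
      (∫ ω, complexBM X s ω ^ p * (starRingEnd ℂ) (complexBM X s ω) ^ j ∂P) *
        ∫ ω, (starRingEnd ℂ) (complexBM X t ω - complexBM X s ω) ^ (p - j) ∂P := by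
    intro j
    refine IndepFun.integral_fun_mul_eq_mul_integral ?_
      (((hm s).pow p).mul ((hm s).conj.pow j)).aestronglyMeasurable
      (hW.conj.pow _).aestronglyMeasurable
    let Φ : (Fin 2 → ℝ) → ℂ := fun x ↦
      (((√2 : ℝ)⁻¹ : ℝ) : ℂ) * x 0 + ((√2 : ℝ)⁻¹ * Complex.I) * x 1
    have hΦ : Continuous Φ := by fun_prop
    have h := (hX.indepFun_increment hst).comp
      (show Measurable fun x ↦ Φ x ^ p * (starRingEnd ℂ) (Φ x) ^ j from
        Continuous.measurable (by fun_prop))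
      (show Measurable fun x ↦ (starRingEnd ℂ) (Φ x) ^ (p - j) from
        Continuous.measurable (by fun_prop))
    have hinc : ∀ ω, complexBM X t ω - complexBM X s ω = Φ fun i ↦ X i t ω - X i s ω := by
      intro ω
      simp only [complexBM, complexComb, Φ]
      push_cast
      ring
    simp_rw [hinc]
    exact h
  simp_rw [h1]
  rw [integral_finsetSum _ fun j _ ↦ ?_, Finset.sum_eq_single p]
  · rw [integral_mul_const, hind, integral_pow_mul_conj_pow_self hX]
    simp
  · intro j hj hjp
    have := Finset.mem_range.1 hj
    rw [integral_mul_const, hind, integral_conj_sub_pow_eq_zero hX s t (by omega), mul_zero,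
      zero_mul]
  · intro h
    exact absurd (Finset.mem_range.2 (by omega)) h
  · exact (((((hm s).pow p).mul ((hm s).conj.pow j)).mul (hW.conj.pow _)).mul
      (HasMoments.const _)).integrable

/-- The contribution `2 Re Z(t)ᵖ` of a pair of conjugate eigenvalues to the trace of the power. -/
noncomputable def pairTerm (p : ℕ) (X : Fin 2 → ℝ≥0 → Ω → ℝ) (t : ℝ≥0) (ω : Ω) : ℝ :=
  2 * (complexBM X t ω ^ p).re

lemma hasMoments_pairTerm (hX : IsBrownianFamily X P) (p : ℕ) (t : ℝ≥0) :
    HasMoments (pairTerm p X t) P :=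
  have := hX.isProbabilityMeasure
  ((hasMoments_complexBM hX t).pow p).re.const_mul 2

lemma ofReal_pairTerm {Ω : Type*} {X : Fin 2 → ℝ≥0 → Ω → ℝ} (p : ℕ) (t : ℝ≥0) (ω : Ω) :
    (pairTerm p X t ω : ℂ) = complexBM X t ω ^ p + (starRingEnd ℂ) (complexBM X t ω) ^ p := by
  rw [← map_pow, Complex.add_conj, pairTerm]

lemma integral_pairTerm (hX : IsBrownianFamily X P) {p : ℕ} (hp : p ≠ 0) (t : ℝ≥0) :
    ∫ ω, pairTerm p X t ω ∂P = 0 := by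
  have := hX.isProbabilityMeasure
  have h := integral_pow_mul_pow_eq_zero hX t t (j := p) (k := 0) hp
  simp only [pow_zero, mul_one] at h
  have hi := ((hasMoments_complexBM hX t).pow p).integrable
  unfold pairTerm
  rw [integral_const_mul]
  have h2 : ∫ ω, (complexBM X t ω ^ p).re ∂P = (∫ ω, complexBM X t ω ^ p ∂P).re := integral_re hi
  rw [h2, h]
  simp

/-- Write `2 Re z = z + conj z` and expand: the two products of equal type vanish, and each of the
two mixed products contributes `p! min(s,t)ᵖ`. -/
lemma integral_pairTerm_mul (hX : IsBrownianFamily X P) {p : ℕ} (hp : p ≠ 0) (s t : ℝ≥0) :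
    ∫ ω, pairTerm p X s ω * pairTerm p X t ω ∂P = 2 * p ! * ((min s t : ℝ≥0) : ℝ) ^ p := by
  wlog hst : s ≤ t generalizing s t
  · simp_rw [mul_comm (pairTerm p X s _), min_comm s t]
    exact this t s (le_of_not_ge hst)
  have := hX.isProbabilityMeasure
  have hm := fun u ↦ hasMoments_complexBM hX u
  have h1 : ∀ ω, ((pairTerm p X s ω * pairTerm p X t ω : ℝ) : ℂ) =
      (complexBM X s ω ^ p * complexBM X t ω ^ p +
        (starRingEnd ℂ) (complexBM X s ω ^ p * complexBM X t ω ^ p)) +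
      (complexBM X s ω ^ p * (starRingEnd ℂ) (complexBM X t ω) ^ p +
        (starRingEnd ℂ) (complexBM X s ω ^ p * (starRingEnd ℂ) (complexBM X t ω) ^ p)) := by
    intro ω
    push_cast
    rw [ofReal_pairTerm, ofReal_pairTerm]
    simp only [map_mul, map_pow, Complex.conj_conj]
    ring
  have hA : HasMoments (fun ω ↦ complexBM X s ω ^ p * complexBM X t ω ^ p) P :=
    ((hm s).pow p).mul ((hm t).pow p)
  have hB : HasMoments (fun ω ↦ complexBM X s ω ^ p * (starRingEnd ℂ) (complexBM X t ω) ^ p) P :=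
    ((hm s).pow p).mul ((hm t).conj.pow p)
  apply Complex.ofReal_injective
  rw [← integral_complex_ofReal]
  simp_rw [h1]
  rw [integral_add (hA.add hA.conj).integrable (hB.add hB.conj).integrable,
    integral_add hA.integrable hA.conj.integrable, integral_add hB.integrable hB.conj.integrable,
    integral_conj, integral_conj, integral_pow_mul_pow_eq_zero hX s t hp,
    integral_pow_mul_conj_pow_of_le hX hst, min_eq_left hst]
  simp
  ring

end ComplexBrownian

/-! ### Roots of unity and the trace of a power of a circulant matrix -/

section Circulant

/-- The `q`-th power of the standard primitive `n`-th root of unity. -/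
noncomputable def unityRoot (n : ℕ) (q : ℤ) : ℂ :=
  Complex.exp ((2 * Real.pi * q / n : ℝ) * Complex.I)

lemma unityRoot_add (n : ℕ) (q r : ℤ) : unityRoot n (q + r) = unityRoot n q * unityRoot n r := by
  rw [unityRoot, unityRoot, unityRoot, ← Complex.exp_add]
  congr 1
  push_cast
  ring

lemma unityRoot_eq_one_of_dvd {n : ℕ} (hn : n ≠ 0) {q : ℤ} (h : (n : ℤ) ∣ q) :
    unityRoot n q = 1 := by
  obtain ⟨r, rfl⟩ := h
  have hn' : (n : ℂ) ≠ 0 := by exact_mod_cast hn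
  rw [unityRoot, Complex.exp_eq_one_iff]
  refine ⟨r, ?_⟩
  push_cast
  field_simp

lemma unityRoot_eq_one_iff {n : ℕ} (hn : n ≠ 0) {q : ℤ} : unityRoot n q = 1 ↔ (n : ℤ) ∣ q := by
  refine ⟨fun h ↦ ?_, unityRoot_eq_one_of_dvd hn⟩
  rw [unityRoot, Complex.exp_eq_one_iff] at h
  obtain ⟨r, hr⟩ := h
  refine ⟨r, ?_⟩
  have hn' : (n : ℂ) ≠ 0 := by exact_mod_cast hn
  have hpi : (Real.pi : ℂ) ≠ 0 := by exact_mod_cast Real.pi_ne_zero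
  push_cast at hr
  field_simp at hr
  have : (q : ℂ) = n * r := by linear_combination hr
  exact_mod_cast this

lemma unityRoot_congr {n : ℕ} (hn : n ≠ 0) {q r : ℤ} (h : (n : ℤ) ∣ q - r) :
    unityRoot n q = unityRoot n r := by
  have h1 := unityRoot_add n (q - r) r
  rwa [sub_add_cancel, unityRoot_eq_one_of_dvd hn h, one_mul] at h1

lemma conj_unityRoot (n : ℕ) (q : ℤ) : (starRingEnd ℂ) (unityRoot n q) = unityRoot n (-q) := by
  rw [unityRoot, unityRoot, ← Complex.exp_conj, map_mul, Complex.conj_ofReal, Complex.conj_I]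
  congr 1
  push_cast
  ring

lemma unityRoot_natCast_mul (n j : ℕ) (q : ℤ) : unityRoot n (j * q) = unityRoot n q ^ j := by
  rw [unityRoot, unityRoot, ← Complex.exp_nat_mul]
  congr 1
  push_cast
  ring

lemma sum_unityRoot {n : ℕ} (hn : n ≠ 0) (q : ℤ) :
    ∑ j : Fin n, unityRoot n ((j : ℕ) * q) = if (n : ℤ) ∣ q then (n : ℂ) else 0 := by
  simp_rw [unityRoot_natCast_mul]
  rw [Fin.sum_univ_eq_sum_range (fun j ↦ unityRoot n q ^ j)]
  split_ifs with h
  · simp [unityRoot_eq_one_of_dvd hn h]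
  · have h1 : unityRoot n q ≠ 1 := fun h' ↦ h ((unityRoot_eq_one_iff hn).1 h')
    rw [geom_sum_eq h1, ← unityRoot_natCast_mul, unityRoot_eq_one_of_dvd hn (dvd_mul_right _ _),
      sub_self, zero_div]

lemma natCast_dvd_sub_iff {n : ℕ} (i j : Fin n) :
    (n : ℤ) ∣ ((i : ℕ) : ℤ) - (j : ℕ) ↔ i = j := by
  constructor
  · intro h
    have hi := i.2
    have hj := j.2
    have := Int.eq_zero_of_abs_lt_dvd h (by rw [abs_lt]; omega)
    ext
    omega
  · rintro rfl
    simp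

/-- The eigenvalues of the circulant matrix with first row `v`. -/
noncomputable def circEigenvalue {n : ℕ} (v : Fin n → ℂ) (k : ℤ) : ℂ :=
  ∑ j, v j * unityRoot n ((j : ℕ) * k)

/-- The columns of the Fourier matrix `F` are common eigenvectors of all circulants: `C F = F D`
with `D` diagonal and `F` invertible, so `Cᵖ` and `Dᵖ` have the same trace. -/
lemma trace_circulant_pow {n : ℕ} (hn : n ≠ 0) (v : Fin n → ℂ) (p : ℕ) :
    (Matrix.of (fun i j ↦ v (j - i)) ^ p).trace =
      ∑ k : Fin n, circEigenvalue v (k : ℕ) ^ p := by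
  have : NeZero n := ⟨hn⟩
  let C : Matrix (Fin n) (Fin n) ℂ := Matrix.of fun i j ↦ v (j - i)
  let F : Matrix (Fin n) (Fin n) ℂ := Matrix.of fun j k ↦ unityRoot n ((j : ℕ) * (k : ℕ))
  let G : Matrix (Fin n) (Fin n) ℂ :=
    Matrix.of fun j k ↦ (n : ℂ)⁻¹ * unityRoot n (-((j : ℕ) * (k : ℕ)))
  let D : Matrix (Fin n) (Fin n) ℂ := Matrix.diagonal fun k ↦ circEigenvalue v (k : ℕ)
  have hn' : (n : ℂ) ≠ 0 := by exact_mod_cast hn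
  have hFG : F * G = 1 := by
    ext i j
    rw [Matrix.mul_apply, Matrix.one_apply]
    have h1 : ∀ k : Fin n, F i k * G k j =
        (n : ℂ)⁻¹ * unityRoot n ((k : ℕ) * (((i : ℕ) : ℤ) - (j : ℕ))) := by
      intro k
      simp only [F, G, Matrix.of_apply]
      rw [mul_left_comm, ← unityRoot_add]
      congr 2
      ring
    simp_rw [h1, ← Finset.mul_sum, sum_unityRoot hn, natCast_dvd_sub_iff]
    split_ifs
    · exact inv_mul_cancel₀ hn'
    · simp
  have hCF : SemiconjBy F D C := by
    show F * D = C * F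
    ext i k
    -- The shift `j = l + i` turns the entry `v (j - i)` into `v l` and extracts the factor `F i k`;
    -- wrap-around modulo `n` is harmless by periodicity.
    rw [Matrix.mul_diagonal, Matrix.mul_apply, ← Equiv.sum_comp (Equiv.addRight i)]
    simp only [F, C, Matrix.of_apply, circEigenvalue, Finset.mul_sum, Equiv.coe_addRight,
      add_sub_cancel_right]
    refine Finset.sum_congr rfl fun l _ ↦ ?_
    rw [mul_left_comm, ← unityRoot_add]
    congr 1
    refine unityRoot_congr hn ?_
    rw [Fin.val_add]
    push_cast
    rw [← add_mul, ← sub_mul, add_comm]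
    refine Dvd.dvd.mul_right ?_ _
    exact Int.dvd_self_sub_emod
  have hpow : F * D ^ p = C ^ p * F := hCF.pow_right p
  calc (C ^ p).trace = (C ^ p * F * G).trace := by rw [mul_assoc, hFG, mul_one]
    _ = (D ^ p).trace := by
        rw [← hpow, mul_assoc, Matrix.trace_mul_comm, mul_assoc, mul_eq_one_comm.1 hFG, mul_one]
    _ = _ := by
        simp [D, Matrix.diagonal_pow, Matrix.trace_diagonal]

/-- A sum over `range n` as a sum over the pairs `{k, n - k}`, and over the remaining indices `0`
and `n / 2`. -/
lemma sum_range_pair {M : Type*} [AddCommMonoid M] (F : ℕ → M) {n : ℕ} (hn : n ≠ 0) :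
    ∑ k ∈ Finset.range n, F k = (F 0 + if Even n then F (n / 2) else 0) +
      ∑ k ∈ Finset.range ((n - 1) / 2), (F (k + 1) + F (n - (k + 1))) := by
  rcases Nat.even_or_odd' n with ⟨m, rfl | rfl⟩
  · obtain ⟨m, rfl⟩ : ∃ m', m = m' + 1 := ⟨m - 1, by omega⟩
    rw [if_pos (by simp), show (2 * (m + 1) - 1) / 2 = m by omega,
      show 2 * (m + 1) / 2 = m + 1 by omega, Finset.sum_add_distrib,
      show 2 * (m + 1) = (m + 1 + m) + 1 by ring, Finset.sum_range_succ', Finset.sum_range_add,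
      Finset.sum_range_succ]
    have h : ∑ k ∈ Finset.range m, F (m + 1 + m + 1 - (k + 1)) =
        ∑ k ∈ Finset.range m, F (m + 1 + k + 1) := by
      rw [← Finset.sum_range_reflect]
      refine Finset.sum_congr rfl fun k hk ↦ ?_
      have := Finset.mem_range.1 hk
      congr 1
      omega
    rw [h]
    abel
  · rw [if_neg (by simp), show (2 * m + 1 - 1) / 2 = m by omega, Finset.sum_add_distrib,
      Finset.sum_range_succ', two_mul, Finset.sum_range_add]
    have h : ∑ k ∈ Finset.range m, F (m + m + 1 - (k + 1)) =
        ∑ k ∈ Finset.range m, F (m + k + 1) := by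
      rw [← Finset.sum_range_reflect]
      refine Finset.sum_congr rfl fun k hk ↦ ?_
      have := Finset.mem_range.1 hk
      congr 1
      omega
    rw [h]
    abel

lemma circEigenvalue_sub {n : ℕ} (hn : n ≠ 0) (v : Fin n → ℝ) (k : ℤ) :
    circEigenvalue (fun j ↦ (v j : ℂ)) (n - k) =
      (starRingEnd ℂ) (circEigenvalue (fun j ↦ (v j : ℂ)) k) := by
  simp only [circEigenvalue, map_sum, map_mul, Complex.conj_ofReal, conj_unityRoot]
  refine Finset.sum_congr rfl fun j _ ↦ ?_
  congr 1
  refine unityRoot_congr hn ⟨(j : ℕ), by ring⟩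

/-- The trace of the `p`-th power of a real circulant matrix. -/
lemma trace_real_circulant_pow {n : ℕ} (hn : n ≠ 0) (v : Fin n → ℝ) (p : ℕ) :
    (Matrix.of (fun i j ↦ v (j - i)) ^ p).trace =
      ((circEigenvalue (fun j ↦ (v j : ℂ)) 0 ^ p).re +
        if Even n then (circEigenvalue (fun j ↦ (v j : ℂ)) ((n / 2 : ℕ) : ℤ) ^ p).re else 0) +
      ∑ k ∈ Finset.range ((n - 1) / 2),
        2 * (circEigenvalue (fun j ↦ (v j : ℂ)) ((k + 1 : ℕ) : ℤ) ^ p).re := by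
  have h1 : (((Matrix.of (fun i j ↦ v (j - i)) ^ p).trace : ℝ) : ℂ) =
      (Matrix.of (fun i j ↦ (v (j - i) : ℂ)) ^ p).trace := by
    have h2 : Matrix.of (fun i j ↦ (v (j - i) : ℂ)) =
        (Complex.ofRealHom.mapMatrix (Matrix.of (fun i j ↦ v (j - i)))) := rfl
    rw [h2, ← map_pow Complex.ofRealHom.mapMatrix]
    exact AddMonoidHom.map_trace Complex.ofRealHom.toAddMonoidHom _
  have h3 := congrArg Complex.re (h1.trans (trace_circulant_pow hn (fun j ↦ (v j : ℂ)) p))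
  rw [Complex.ofReal_re, Fin.sum_univ_eq_sum_range
    (fun k ↦ circEigenvalue (fun j ↦ (v j : ℂ)) (k : ℤ) ^ p), Complex.re_sum,
    sum_range_pair _ hn] at h3
  rw [h3]
  congr 1
  refine Finset.sum_congr rfl fun k hk ↦ ?_
  have hk' := Finset.mem_range.1 hk
  have : ((n - (k + 1) : ℕ) : ℤ) = n - ((k + 1 : ℕ) : ℤ) := by
    rw [Nat.cast_sub (by omega)]
  rw [this, circEigenvalue_sub hn, ← map_pow, Complex.conj_re, two_mul]

end Circulant

/-! ### The eigenvalue processes of the circulant matrix -/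

section Eigenvalues

variable {Ω : Type*} [MeasurableSpace Ω] {P : Measure Ω} {b : ℕ → ℝ≥0 → Ω → ℝ}

/-- The coefficients of `√2 Re λ_{k+1}` and `√2 Im λ_{k+1}` with respect to the entries. -/
noncomputable def pairRow (n : ℕ) (q : Fin ((n - 1) / 2) × Fin 2) (j : Fin n) : ℝ :=
  √2 / √n * ![(unityRoot n ((j : ℕ) * ((q.1 : ℕ) + 1))).re,
    (unityRoot n ((j : ℕ) * ((q.1 : ℕ) + 1))).im] q.2

/-- The four kinds of products of real and imaginary parts come from two character sums: `∑ x_k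
conj(x_l)` is `n` or `0`, and `∑ x_k x_l` is `0`. -/
lemma sum_pairRow_mul (n : ℕ) (q r : Fin ((n - 1) / 2) × Fin 2) :
    ∑ j, pairRow n q j * pairRow n r j = if q = r then 1 else 0 := by
  obtain ⟨k, c⟩ := q
  obtain ⟨l, d⟩ := r
  have hk := k.2
  have hl := l.2
  have hn : n ≠ 0 := by omega
  have hn' : (0 : ℝ) < n := by exact_mod_cast Nat.pos_of_ne_zero hn
  let x : Fin ((n - 1) / 2) → Fin n → ℂ := fun k j ↦ unityRoot n ((j : ℕ) * ((k : ℕ) + 1))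
  have hA : ∑ j, x k j * (starRingEnd ℂ) (x l j) = if k = l then (n : ℂ) else 0 := by
    have h1 : ∀ j, x k j * (starRingEnd ℂ) (x l j) =
        unityRoot n ((j : ℕ) * (((k : ℕ) : ℤ) - (l : ℕ))) := by
      intro j
      simp only [x]
      rw [conj_unityRoot, ← unityRoot_add]
      congr 1
      ring
    simp_rw [h1, sum_unityRoot hn]
    refine if_congr ?_ rfl rfl
    constructor
    · intro h
      have := Int.eq_zero_of_abs_lt_dvd h (by rw [abs_lt]; omega)
      ext
      omega
    · rintro rfl
      simp
  -- The frequencies `k + 1` and `l + 1` are at most `(n - 1) / 2`, so their sum lies strictly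
  -- between `0` and `n`. This is where the self-conjugate indices must be excluded.
  have hB : ∑ j, x k j * x l j = 0 := by
    have h1 : ∀ j, x k j * x l j = unityRoot n ((j : ℕ) * (((k : ℕ) : ℤ) + (l : ℕ) + 2)) := by
      intro j
      simp only [x]
      rw [← unityRoot_add]
      congr 1
      ring
    simp_rw [h1]
    rw [sum_unityRoot hn, if_neg]
    intro h
    have := Int.eq_zero_of_abs_lt_dvd h (by rw [abs_lt]; omega)
    omega
  have hAre := congrArg Complex.re hA
  have hAim := congrArg Complex.im hA
  have hBre := congrArg Complex.re hB
  have hBim := congrArg Complex.im hB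
  simp only [Complex.re_sum, Complex.im_sum, Complex.mul_re, Complex.mul_im, Complex.conj_re,
    Complex.conj_im, Complex.zero_re, Complex.zero_im, Finset.sum_sub_distrib,
    Finset.sum_add_distrib, mul_neg, Finset.sum_neg_distrib] at hAre hAim hBre hBim
  have hsq : √2 / √(n : ℝ) * (√2 / √n) = 2 / n := by
    rw [div_mul_div_comm, Real.mul_self_sqrt (by norm_num), Real.mul_self_sqrt hn'.le]
  have hprod : ∀ u v : ℝ, √2 / √(n : ℝ) * u * (√2 / √n * v) = 2 / n * (u * v) := by
    intro u v
    rw [← hsq]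
    ring
  have hif : (if k = l then (n : ℂ) else 0).re = if k = l then (n : ℝ) else 0 := by
    split_ifs <;> simp
  have hif' : (if k = l then (n : ℂ) else 0).im = 0 := by
    split_ifs <;> simp
  rw [hif] at hAre
  rw [hif'] at hAim
  simp only [pairRow, hprod, ← Finset.mul_sum, Prod.mk.injEq]
  have hval : 2 / (n : ℝ) * ((if k = l then (n : ℝ) else 0) / 2) = if k = l then 1 else 0 := by
    split_ifs
    · field_simp
    · simp
  fin_cases c <;> fin_cases d <;>
    simp only [Fin.zero_eta, Fin.mk_one, Matrix.cons_val_zero, Matrix.cons_val_one, and_true,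
      Fin.isValue, zero_ne_one, one_ne_zero, and_false, if_false]
  · rw [← hval]
    congr 1
    simp only [x] at hAre hBre
    linarith
  · rw [mul_eq_zero]
    right
    simp only [x] at hAim hBim
    linarith
  · rw [mul_eq_zero]
    right
    simp only [x] at hAim hBim
    linarith
  · rw [← hval]
    congr 1
    simp only [x] at hAre hBre
    linarith

/-- The processes `√2 Re λ_{k+1}` and `√2 Im λ_{k+1}`. -/
noncomputable def pairBM (b : ℕ → ℝ≥0 → Ω → ℝ) (n : ℕ) (q : Fin ((n - 1) / 2) × Fin 2) (t : ℝ≥0)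
    (ω : Ω) : ℝ :=
  ∑ j : Fin n, pairRow n q j * b j t ω

lemma isBrownianFamily_pairBM (hb : IsBrownianFamily b P) (n : ℕ) :
    IsBrownianFamily (pairBM b n) P :=
  (hb.comp_injective (Fin.val_injective (n := n))).sum_orthonormal (sum_pairRow_mul n)

/-- The real eigenvalue `λ_e`, for `n ∣ 2 e`. -/
noncomputable def realBM (b : ℕ → ℝ≥0 → Ω → ℝ) (n e : ℕ) (t : ℝ≥0) (ω : Ω) : ℝ :=
  ∑ j : Fin n, (unityRoot n ((j : ℕ) * (e : ℤ))).re / √n * b j t ω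

lemma im_unityRoot_eq_zero {n e : ℕ} (hn : n ≠ 0) (he : n ∣ 2 * e) (j : ℕ) :
    (unityRoot n (j * (e : ℤ))).im = 0 := by
  rw [← Complex.conj_eq_iff_im, conj_unityRoot]
  refine unityRoot_congr hn ?_
  have h1 : (n : ℤ) ∣ 2 * e := by exact_mod_cast he
  have h2 : -((j : ℤ) * e) - j * e = (2 * e) * (-j) := by ring
  rw [h2]
  exact h1.mul_right _

/-- The roots of unity involved are `±1`, so the coefficients form a unit vector: a one-row
orthonormal family. Independence from the other eigenvalues is not needed, since this part is
negligible. -/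
lemma isBrownianReal_realBM (hb : IsBrownianFamily b P) {n e : ℕ} (hn : n ≠ 0)
    (he : n ∣ 2 * e) : IsBrownianReal (realBM b n e) P := by
  have hn' : (0 : ℝ) < n := by exact_mod_cast Nat.pos_of_ne_zero hn
  refine ((hb.comp_injective (Fin.val_injective (n := n))).sum_orthonormal (κ := Unit)
    (a := fun _ j ↦ (unityRoot n ((j : ℕ) * (e : ℤ))).re / √n) fun k l ↦ ?_).brownian ()
  have h1 : ∀ j : Fin n, (unityRoot n ((j : ℕ) * (e : ℤ))).re / √n *
      ((unityRoot n ((j : ℕ) * (e : ℤ))).re / √n) = 1 / n := by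
    intro j
    have h2 : ‖unityRoot n ((j : ℕ) * (e : ℤ))‖ = 1 := Complex.norm_exp_ofReal_mul_I _
    have h3 := Complex.normSq_apply (unityRoot n ((j : ℕ) * (e : ℤ)))
    rw [Complex.normSq_eq_norm_sq, h2, im_unityRoot_eq_zero hn he, one_pow, mul_zero,
      add_zero] at h3
    rw [div_mul_div_comm, Real.mul_self_sqrt hn'.le, ← h3]
  simp_rw [h1]
  simp [hn]

lemma circEigenvalue_eq_realBM {Ω : Type*} {b : ℕ → ℝ≥0 → Ω → ℝ} {n e : ℕ} (hn : n ≠ 0)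
    (he : n ∣ 2 * e) (t : ℝ≥0) (ω : Ω) :
    circEigenvalue (fun j : Fin n ↦ ((b j t ω / √n : ℝ) : ℂ)) e = (realBM b n e t ω : ℂ) := by
  rw [circEigenvalue, realBM, Complex.ofReal_sum]
  refine Finset.sum_congr rfl fun j _ ↦ ?_
  have h1 : unityRoot n ((j : ℕ) * (e : ℤ)) = ((unityRoot n ((j : ℕ) * (e : ℤ))).re : ℂ) := by
    apply Complex.ext <;> simp [im_unityRoot_eq_zero hn he]
  conv_lhs => rw [h1]
  push_cast
  ring

lemma circEigenvalue_eq_complexBM {Ω : Type*} {b : ℕ → ℝ≥0 → Ω → ℝ} (n : ℕ)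
    (k : Fin ((n - 1) / 2)) (t : ℝ≥0) (ω : Ω) :
    circEigenvalue (fun j : Fin n ↦ ((b j t ω / √n : ℝ) : ℂ)) (((k : ℕ) + 1 : ℕ) : ℤ) =
      complexBM (fun c ↦ pairBM b n (k, c)) t ω := by
  have hs : (√2 : ℂ) ≠ 0 := by
    exact_mod_cast (Real.sqrt_pos.2 (by norm_num : (0 : ℝ) < 2)).ne'
  simp only [circEigenvalue, complexBM, complexComb, pairBM, Complex.ofReal_sum, Finset.mul_sum,
    ← Finset.sum_add_distrib]
  refine Finset.sum_congr rfl fun j _ ↦ ?_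
  have h1 := Complex.re_add_im (unityRoot n ((j : ℕ) * ((((k : ℕ) + 1 : ℕ)) : ℤ)))
  rw [← h1]
  simp only [pairRow, Matrix.cons_val_zero, Matrix.cons_val_one]
  push_cast
  field_simp

/-- The contribution of the real eigenvalues to the trace of the `p`-th power. -/
noncomputable def realPart (p : ℕ) (b : ℕ → ℝ≥0 → Ω → ℝ) (n : ℕ) (t : ℝ≥0) (ω : Ω) : ℝ :=
  realBM b n 0 t ω ^ p + if Even n then realBM b n (n / 2) t ω ^ p else 0

/-- The contribution of the other eigenvalues to the trace of the `p`-th power. -/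
noncomputable def pairSum (p : ℕ) (b : ℕ → ℝ≥0 → Ω → ℝ) (n : ℕ) (t : ℝ≥0) (ω : Ω) : ℝ :=
  ∑ k, pairTerm p (fun c ↦ pairBM b n (k, c)) t ω

lemma trace_circ_pow {Ω : Type*} {b : ℕ → ℝ≥0 → Ω → ℝ} {n : ℕ} (hn : n ≠ 0) (p : ℕ)
    (t : ℝ≥0) (ω : Ω) : (circ b n t ω ^ p).trace = realPart p b n t ω + pairSum p b n t ω := by
  have h := trace_real_circulant_pow hn (fun j : Fin n ↦ b j t ω / √n) p
  refine Eq.trans h ?_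
  congr 1
  · have h0 := circEigenvalue_eq_realBM (b := b) (e := 0) hn (by simp) t ω
    rw [Nat.cast_zero] at h0
    rw [h0, realPart, ← Complex.ofReal_pow, Complex.ofReal_re]
    congr 1
    split_ifs with he
    · rw [circEigenvalue_eq_realBM hn (by rw [Nat.mul_div_cancel' he.two_dvd]),
        ← Complex.ofReal_pow,
        Complex.ofReal_re]
    · rfl
  · rw [← Fin.sum_univ_eq_sum_range (fun k ↦ 2 * (circEigenvalue
      (fun j : Fin n ↦ ((b j t ω / √n : ℝ) : ℂ)) ((k + 1 : ℕ) : ℤ) ^ p).re)]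
    refine Finset.sum_congr rfl fun k _ ↦ ?_
    rw [circEigenvalue_eq_complexBM, pairTerm]

lemma isBrownianFamily_pair (hb : IsBrownianFamily b P) {n : ℕ} (k : Fin ((n - 1) / 2)) :
    IsBrownianFamily (fun c : Fin 2 ↦ pairBM b n (k, c)) P :=
  (isBrownianFamily_pairBM hb n).comp_injective fun c d h ↦ by simpa using h

lemma hasMoments_realPart (hb : IsBrownianFamily b P) {n : ℕ} (hn : n ≠ 0) (p : ℕ) (t : ℝ≥0) :
    HasMoments (realPart p b n t) P := by
  have := hb.isProbabilityMeasure
  unfold realPart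
  refine ((IsBrownianReal.hasMoments (isBrownianReal_realBM hb hn (by simp)) t).pow p).add ?_
  split_ifs with he
  · exact (IsBrownianReal.hasMoments (isBrownianReal_realBM hb hn
      (by rw [Nat.mul_div_cancel' he.two_dvd])) t).pow p
  · exact HasMoments.const 0

lemma hasMoments_pairSum (hb : IsBrownianFamily b P) (n p : ℕ) (t : ℝ≥0) :
    HasMoments (pairSum p b n t) P :=
  HasMoments.sum fun k _ ↦ hasMoments_pairTerm (isBrownianFamily_pair hb k) p t

lemma hasMoments_trace (hb : IsBrownianFamily b P) (p n : ℕ) (t : ℝ≥0) :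
    HasMoments (fun ω ↦ (circ b n t ω ^ p).trace) P := by
  have := hb.isProbabilityMeasure
  rcases eq_or_ne n 0 with rfl | hn
  · simpa [Matrix.trace] using HasMoments.const (P := P) (0 : ℝ)
  · simp_rw [trace_circ_pow hn]
    exact (hasMoments_realPart hb hn p t).add (hasMoments_pairSum hb n p t)

lemma integral_pairSum (hb : IsBrownianFamily b P) (n : ℕ) {p : ℕ} (hp : p ≠ 0) (t : ℝ≥0) :
    ∫ ω, pairSum p b n t ω ∂P = 0 := by
  unfold pairSum
  rw [integral_finsetSum _ fun k _ ↦
    (hasMoments_pairTerm (isBrownianFamily_pair hb k) p t).integrable]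
  exact Finset.sum_eq_zero fun k _ ↦ integral_pairTerm (isBrownianFamily_pair hb k) hp t

lemma integral_trace (hb : IsBrownianFamily b P) {n : ℕ} (hn : n ≠ 0) {p : ℕ} (hp : p ≠ 0)
    (t : ℝ≥0) : ∫ ω, (circ b n t ω ^ p).trace ∂P = ∫ ω, realPart p b n t ω ∂P := by
  simp_rw [trace_circ_pow hn]
  rw [integral_add (hasMoments_realPart hb hn p t).integrable
    (hasMoments_pairSum hb n p t).integrable, integral_pairSum hb n hp, add_zero]

/-- The pairs have mean zero, so the centring affects the real eigenvalues only. -/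
lemma fluct_eq (hb : IsBrownianFamily b P) {n : ℕ} (hn : n ≠ 0) {p : ℕ} (hp : p ≠ 0) (t : ℝ≥0)
    (ω : Ω) :
    fluct P b p n t ω = (√(n : ℝ))⁻¹ *
      ((realPart p b n t ω - ∫ ω', realPart p b n t ω' ∂P) + pairSum p b n t ω) := by
  rw [fluct, integral_trace hb hn hp, trace_circ_pow hn]
  ring

end Eigenvalues

/-! ### Fourth moments -/

section FourthMoment

variable {Ω : Type*} [MeasurableSpace Ω] {P : Measure Ω}

lemma sq_integral_le [IsProbabilityMeasure P] {f : Ω → ℝ} (hf : HasMoments f P) :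
    (∫ ω, f ω ∂P) ^ 2 ≤ ∫ ω, f ω ^ 2 ∂P := by
  have h := variance_nonneg f P
  rw [variance_eq_sub (hf 2)] at h
  simp only [Pi.pow_apply] at h
  linarith

/-- Jensen's inequality for the square, used twice. -/
lemma pow_four_integral_le [IsProbabilityMeasure P] {f : Ω → ℝ} (hf : HasMoments f P) :
    (∫ ω, f ω ∂P) ^ 4 ≤ ∫ ω, f ω ^ 4 ∂P := by
  have h1 := sq_integral_le hf
  have h2 := sq_integral_le (hf.pow 2)
  simp_rw [← pow_mul] at h2
  calc (∫ ω, f ω ∂P) ^ 4 = ((∫ ω, f ω ∂P) ^ 2) ^ 2 := by ring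
    _ ≤ (∫ ω, f ω ^ 2 ∂P) ^ 2 := by gcongr
    _ ≤ _ := h2

lemma add_pow_four_le (x y : ℝ) : (x + y) ^ 4 ≤ 8 * (x ^ 4 + y ^ 4) := by
  nlinarith [sq_nonneg (x - y), sq_nonneg (x + y), sq_nonneg (x ^ 2 - y ^ 2),
    mul_nonneg (sq_nonneg (x - y)) (sq_nonneg (x + y)), sq_nonneg ((x - y) ^ 2),
    mul_nonneg (sq_nonneg (x - y)) (sq_nonneg x), mul_nonneg (sq_nonneg (x - y)) (sq_nonneg y)]

lemma integral_add_pow_four_le {f g : Ω → ℝ} [IsProbabilityMeasure P] (hf : HasMoments f P)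
    (hg : HasMoments g P) {A B : ℝ} (hA : ∫ ω, f ω ^ 4 ∂P ≤ A) (hB : ∫ ω, g ω ^ 4 ∂P ≤ B) :
    ∫ ω, (f ω + g ω) ^ 4 ∂P ≤ 8 * (A + B) := by
  calc ∫ ω, (f ω + g ω) ^ 4 ∂P ≤ ∫ ω, 8 * (f ω ^ 4 + g ω ^ 4) ∂P :=
        integral_mono ((hf.add hg).pow 4).integrable
          (((hf.pow 4).add (hg.pow 4)).const_mul 8).integrable fun ω ↦ add_pow_four_le _ _
    _ ≤ _ := by
        rw [integral_const_mul, integral_add (hf.pow 4).integrable (hg.pow 4).integrable]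
        gcongr

lemma integral_sub_integral_pow_four_le {f : Ω → ℝ} [IsProbabilityMeasure P]
    (hf : HasMoments f P) {A : ℝ} (hA : ∫ ω, f ω ^ 4 ∂P ≤ A) :
    ∫ ω, (f ω - ∫ ω', f ω' ∂P) ^ 4 ∂P ≤ 16 * A := by
  simp_rw [sub_eq_add_neg]
  refine (integral_add_pow_four_le hf (HasMoments.const _) hA (B := A) ?_).trans (by linarith)
  have h : (-∫ ω', f ω' ∂P) ^ 4 = (∫ ω', f ω' ∂P) ^ 4 := by ring
  rw [h, integral_const, probReal_univ, one_smul]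
  exact (pow_four_integral_le hf).trans hA

/-- Second and fourth moments of a sum of independent centred random variables. -/
lemma integral_sum_pow_le {ι : Type*} {D : ι → Ω → ℝ} (hind : iIndepFun D P)
    (hm : ∀ i, HasMoments (D i) P) (h0 : ∀ i, ∫ ω, D i ω ∂P = 0) {σ K : ℝ} (hσ : 0 ≤ σ)
    (h2 : ∀ i, ∫ ω, D i ω ^ 2 ∂P ≤ σ) (h4 : ∀ i, ∫ ω, D i ω ^ 4 ∂P ≤ K) (hK : σ ^ 2 ≤ K)
    (s : Finset ι) :
    ∫ ω, (∑ i ∈ s, D i ω) ^ 2 ∂P ≤ s.card * σ ∧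
      ∫ ω, (∑ i ∈ s, D i ω) ^ 4 ∂P ≤ 3 * (s.card : ℝ) ^ 2 * K := by
  classical
  have := hind.isProbabilityMeasure
  induction s using Finset.induction_on with
  | empty => simp
  | insert i s hi ih =>
    obtain ⟨ih2, ih4⟩ := ih
    let S : Ω → ℝ := fun ω ↦ ∑ j ∈ s, D j ω
    have hS : HasMoments S P := HasMoments.sum fun j _ ↦ hm j
    have hS0 : ∫ ω, S ω ∂P = 0 := by
      simp only [S]
      rw [integral_finsetSum _ fun j _ ↦ (hm j).integrable]
      exact Finset.sum_eq_zero fun j _ ↦ h0 j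
    have hSD : IndepFun S (D i) P := by
      have h := hind.indepFun_finsetSum_of_notMem₀
        (fun j ↦ (hm j).aestronglyMeasurable.aemeasurable) hi
      have : (∑ j ∈ s, D j) = S := by
        ext ω
        simp [S]
      rwa [this] at h
    have hprod : ∀ a c : ℕ, ∫ ω, S ω ^ a * D i ω ^ c ∂P =
        (∫ ω, S ω ^ a ∂P) * ∫ ω, D i ω ^ c ∂P := fun a c ↦
      IndepFun.integral_fun_mul_eq_mul_integral
        (hSD.comp (measurable_id.pow_const a) (measurable_id.pow_const c))
        (hS.pow a).aestronglyMeasurable ((hm i).pow c).aestronglyMeasurable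
    have hint : ∀ a c : ℕ, Integrable (fun ω ↦ S ω ^ a * D i ω ^ c) P := fun a c ↦
      ((hS.pow a).mul ((hm i).pow c)).integrable
    have hcard : ((insert i s).card : ℝ) = s.card + 1 := by
      rw [Finset.card_insert_of_notMem hi]
      push_cast
      rfl
    have hD2 : 0 ≤ ∫ ω, D i ω ^ 2 ∂P := integral_nonneg fun ω ↦ by positivity
    have hS2 : 0 ≤ ∫ ω, S ω ^ 2 ∂P := integral_nonneg fun ω ↦ by positivity
    -- All terms are put in the form `S ^ a * D ^ c`, zero exponents included, so that one
    -- factorisation by independence handles them.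
    have e2 : ∀ ω, (∑ j ∈ insert i s, D j ω) ^ 2 =
        (S ω ^ 2 * D i ω ^ 0 + 2 * (S ω ^ 1 * D i ω ^ 1)) + S ω ^ 0 * D i ω ^ 2 := by
      intro ω
      rw [Finset.sum_insert hi]
      ring
    have e4 : ∀ ω, (∑ j ∈ insert i s, D j ω) ^ 4 =
        (((S ω ^ 4 * D i ω ^ 0 + 4 * (S ω ^ 3 * D i ω ^ 1)) + 6 * (S ω ^ 2 * D i ω ^ 2)) +
          4 * (S ω ^ 1 * D i ω ^ 3)) + S ω ^ 0 * D i ω ^ 4 := by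
      intro ω
      rw [Finset.sum_insert hi]
      ring
    simp_rw [e2, e4]
    have i1 := hint 4 0
    have i2 := (hint 3 1).const_mul 4
    have i3 := (hint 2 2).const_mul 6
    have i4 := (hint 1 3).const_mul 4
    have i5 := (hint 1 1).const_mul 2
    have j2 : Integrable (fun ω ↦ S ω ^ 4 * D i ω ^ 0 + 4 * (S ω ^ 3 * D i ω ^ 1)) P := i1.add i2
    have j3 : Integrable (fun ω ↦ S ω ^ 4 * D i ω ^ 0 + 4 * (S ω ^ 3 * D i ω ^ 1) +
      6 * (S ω ^ 2 * D i ω ^ 2)) P := j2.add i3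
    have j4 : Integrable (fun ω ↦ S ω ^ 4 * D i ω ^ 0 + 4 * (S ω ^ 3 * D i ω ^ 1) +
      6 * (S ω ^ 2 * D i ω ^ 2) + 4 * (S ω ^ 1 * D i ω ^ 3)) P := j3.add i4
    have j5 : Integrable (fun ω ↦ S ω ^ 2 * D i ω ^ 0 + 2 * (S ω ^ 1 * D i ω ^ 1)) P :=
      (hint 2 0).add i5
    rw [hcard, integral_add j4 (hint 0 4), integral_add j3 i4, integral_add j2 i3,
      integral_add i1 i2, integral_add j5 (hint 0 2), integral_add (hint 2 0) i5]
    simp_rw [integral_const_mul, hprod, pow_one, h0, hS0]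
    simp only [pow_zero, integral_const, probReal_univ, one_smul, mul_one, mul_zero, zero_mul,
      add_zero, one_mul]
    refine ⟨by linarith [h2 i], ?_⟩
    -- Terms linear in `S` or `D` vanish, so `E S² E D²` is the only cross term left. The induction
    -- closes because `3 m² + 6 m + 1 ≤ 3 (m + 1)²`.
    have hc : (∫ ω, S ω ^ 2 ∂P) * ∫ ω, D i ω ^ 2 ∂P ≤ s.card * K := by
      calc (∫ ω, S ω ^ 2 ∂P) * ∫ ω, D i ω ^ 2 ∂P ≤ (s.card * σ) * σ := by
            gcongr
            exact h2 i
        _ = s.card * σ ^ 2 := by ring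
        _ ≤ _ := by gcongr
    have hK0 : 0 ≤ K := (sq_nonneg σ).trans hK
    have := h4 i
    nlinarith

end FourthMoment

/-! ### Fourth moments of the increments of the fluctuation process. -/

section FluctMoment

variable {Ω : Type*} [MeasurableSpace Ω] {P : Measure Ω} {b : ℕ → ℝ≥0 → Ω → ℝ}

/-- The path space itself serves as sample space, with coordinate processes. This presents the
variables as measurable functions of blocks of Brownian motions, to which independence transfers. -/
lemma measurable_complexBM_eval (t : ℝ≥0) : Measurable fun x : Fin 2 × ℝ≥0 → ℝ ↦
    complexBM (fun c t x ↦ x (c, t)) t x := by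
  unfold complexBM complexComb
  fun_prop

lemma measurable_pairTerm_eval (p : ℕ) (t : ℝ≥0) : Measurable fun x : Fin 2 × ℝ≥0 → ℝ ↦
    pairTerm p (fun c t x ↦ x (c, t)) t x := by
  have h : Measurable fun z : ℂ ↦ 2 * (z ^ p).re := Continuous.measurable (by fun_prop)
  exact h.comp (measurable_complexBM_eval t)

/-- The bound is taken as a hypothesis quantified over all processes so that a single `C` serves
every eigenvalue and every `n`. The factor is `16 = 2⁴`. -/
lemma integral_pairTerm_sub_pow_four_le {X : Fin 2 → ℝ≥0 → Ω → ℝ} (hX : IsBrownianFamily X P)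
    {p : ℕ} {T : ℝ≥0} {C : ℝ}
    (hC : ∀ {α β : ℂ}, ‖α‖ ≤ 1 → ‖β‖ ≤ 1 → ∀ {X Y : ℝ≥0 → Ω → ℝ}, IsBrownianReal X P →
      IsBrownianReal Y P → ∀ {s t : ℝ≥0}, s ≤ t → t ≤ T →
      ∫ ω, ‖complexComb α β X Y t ω ^ p - complexComb α β X Y s ω ^ p‖ ^ 4 ∂P ≤
        C * ((t : ℝ) - s) ^ 2)
    {s t : ℝ≥0} (hst : s ≤ t) (htT : t ≤ T) :
    ∫ ω, (pairTerm p X t ω - pairTerm p X s ω) ^ 4 ∂P ≤ 16 * (C * ((t : ℝ) - s) ^ 2) := by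
  have := hX.isProbabilityMeasure
  have h2 : ‖((√2 : ℝ)⁻¹ : ℂ)‖ ≤ 1 := by
    rw [norm_inv, Complex.norm_real, Real.norm_of_nonneg (Real.sqrt_nonneg 2)]
    exact inv_le_one_of_one_le₀ (Real.one_le_sqrt.2 (by norm_num))
  have h := hC (α := ((√2 : ℝ)⁻¹ : ℝ)) (β := (√2 : ℝ)⁻¹ * Complex.I) (by simpa using h2)
    (by simpa using h2) (hX.brownian 0) (hX.brownian 1) hst htT
  calc ∫ ω, (pairTerm p X t ω - pairTerm p X s ω) ^ 4 ∂P
      ≤ ∫ ω, 16 * ‖complexBM X t ω ^ p - complexBM X s ω ^ p‖ ^ 4 ∂P := by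
        refine integral_mono (((hasMoments_pairTerm hX p t).sub
          (hasMoments_pairTerm hX p s)).pow 4).integrable
          ((((hasMoments_complexBM hX t).pow p).sub
          ((hasMoments_complexBM hX s).pow p)).norm.pow 4 |>.const_mul 16).integrable fun ω ↦ ?_
        have h1 : pairTerm p X t ω - pairTerm p X s ω =
            2 * (complexBM X t ω ^ p - complexBM X s ω ^ p).re := by
          simp only [pairTerm, Complex.sub_re]
          ring
        have h3 := pow_le_pow_left₀ (abs_nonneg _)
          (Complex.abs_re_le_norm (complexBM X t ω ^ p - complexBM X s ω ^ p)) 4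
        rw [Even.pow_abs (by decide)] at h3
        simp only [h1, mul_pow]
        linarith
    _ ≤ _ := by
        rw [integral_const_mul]
        gcongr
        exact h

lemma integral_realBM_pow_sub_pow_four_le {X : ℝ≥0 → Ω → ℝ} (hX : IsBrownianReal X P)
    {p : ℕ} {T : ℝ≥0} {C : ℝ}
    (hC : ∀ {α β : ℂ}, ‖α‖ ≤ 1 → ‖β‖ ≤ 1 → ∀ {X Y : ℝ≥0 → Ω → ℝ}, IsBrownianReal X P →
      IsBrownianReal Y P → ∀ {s t : ℝ≥0}, s ≤ t → t ≤ T →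
      ∫ ω, ‖complexComb α β X Y t ω ^ p - complexComb α β X Y s ω ^ p‖ ^ 4 ∂P ≤
        C * ((t : ℝ) - s) ^ 2)
    {s t : ℝ≥0} (hst : s ≤ t) (htT : t ≤ T) :
    ∫ ω, (X t ω ^ p - X s ω ^ p) ^ 4 ∂P ≤ C * ((t : ℝ) - s) ^ 2 := by
  refine le_of_eq_of_le ?_ (hC (α := 1) (β := 0) (by simp) (by simp) hX hX hst htT)
  congr with ω
  have h1 : complexComb 1 0 X X t ω ^ p - complexComb 1 0 X X s ω ^ p =
      ((X t ω ^ p - X s ω ^ p : ℝ) : ℂ) := by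
    simp [complexComb]
  rw [h1, Complex.norm_real, Real.norm_eq_abs, Even.pow_abs (by decide)]

lemma integral_realPart_sub_pow_four_le (hb : IsBrownianFamily b P) {n : ℕ} (hn : n ≠ 0)
    {p : ℕ} {T : ℝ≥0} {C : ℝ} (hC0 : 0 ≤ C)
    (hC : ∀ {α β : ℂ}, ‖α‖ ≤ 1 → ‖β‖ ≤ 1 → ∀ {X Y : ℝ≥0 → Ω → ℝ}, IsBrownianReal X P →
      IsBrownianReal Y P → ∀ {s t : ℝ≥0}, s ≤ t → t ≤ T →
      ∫ ω, ‖complexComb α β X Y t ω ^ p - complexComb α β X Y s ω ^ p‖ ^ 4 ∂P ≤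
        C * ((t : ℝ) - s) ^ 2)
    {s t : ℝ≥0} (hst : s ≤ t) (htT : t ≤ T) :
    ∫ ω, (realPart p b n t ω - realPart p b n s ω) ^ 4 ∂P ≤ 16 * (C * ((t : ℝ) - s) ^ 2) := by
  have := hb.isProbabilityMeasure
  have h0 := isBrownianReal_realBM hb hn (e := 0) (by simp)
  have hA := integral_realBM_pow_sub_pow_four_le h0 hC hst htT
  have hm0 := ((IsBrownianReal.hasMoments h0 t).pow p).sub ((IsBrownianReal.hasMoments h0 s).pow p)
  unfold realPart
  split_ifs with he
  · have h1 := isBrownianReal_realBM hb hn (e := n / 2) (by rw [Nat.mul_div_cancel' he.two_dvd])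
    have hB := integral_realBM_pow_sub_pow_four_le h1 hC hst htT
    have hm1 := ((IsBrownianReal.hasMoments h1 t).pow p).sub
      ((IsBrownianReal.hasMoments h1 s).pow p)
    simp_rw [add_sub_add_comm]
    exact (integral_add_pow_four_le hm0 hm1 hA hB).trans (by linarith)
  · simp_rw [add_zero]
    refine hA.trans ?_
    have : 0 ≤ C * ((t : ℝ) - s) ^ 2 := by positivity
    linarith

lemma integral_pairSum_sub_pow_four_le (hb : IsBrownianFamily b P) (n : ℕ)
    {p : ℕ} (hp : p ≠ 0) {T : ℝ≥0} {C : ℝ}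
    (hC : ∀ {α β : ℂ}, ‖α‖ ≤ 1 → ‖β‖ ≤ 1 → ∀ {X Y : ℝ≥0 → Ω → ℝ}, IsBrownianReal X P →
      IsBrownianReal Y P → ∀ {s t : ℝ≥0}, s ≤ t → t ≤ T →
      ∫ ω, ‖complexComb α β X Y t ω ^ p - complexComb α β X Y s ω ^ p‖ ^ 4 ∂P ≤
        C * ((t : ℝ) - s) ^ 2)
    {s t : ℝ≥0} (hst : s ≤ t) (htT : t ≤ T) :
    ∫ ω, (pairSum p b n t ω - pairSum p b n s ω) ^ 4 ∂P ≤
      3 * (((n - 1) / 2 : ℕ) : ℝ) ^ 2 * (16 * (C * ((t : ℝ) - s) ^ 2)) := by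
  have := hb.isProbabilityMeasure
  let D : Fin ((n - 1) / 2) → Ω → ℝ := fun k ω ↦
    pairTerm p (fun c ↦ pairBM b n (k, c)) t ω - pairTerm p (fun c ↦ pairBM b n (k, c)) s ω
  have hm : ∀ k u, HasMoments (pairTerm p (fun c ↦ pairBM b n (k, c)) u) P := fun k u ↦
    hasMoments_pairTerm (isBrownianFamily_pair hb k) p u
  have hDm : ∀ k, HasMoments (D k) P := fun k ↦ (hm k t).sub (hm k s)
  have hD0 : ∀ k, ∫ ω, D k ω ∂P = 0 := by
    intro k
    simp only [D]
    rw [integral_sub (hm k t).integrable (hm k s).integrable,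
      integral_pairTerm (isBrownianFamily_pair hb k) hp,
      integral_pairTerm (isBrownianFamily_pair hb k) hp, sub_zero]
  have hind : iIndepFun D P :=
    (isBrownianFamily_pairBM hb n).indep_blocks.comp
      (fun _ x ↦ pairTerm p (fun c t x ↦ x (c, t)) t x - pairTerm p (fun c t x ↦ x (c, t)) s x)
      fun _ ↦ (measurable_pairTerm_eval p t).sub (measurable_pairTerm_eval p s)
  let K : ℝ := 16 * (C * ((t : ℝ) - s) ^ 2)
  have h4 : ∀ k, ∫ ω, D k ω ^ 4 ∂P ≤ K := fun k ↦
    integral_pairTerm_sub_pow_four_le (isBrownianFamily_pair hb k) hC hst htT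
  -- With `σ = √K`, Jensen gives the second moment bound and `σ² ≤ K` holds automatically.
  have h2 : ∀ k, ∫ ω, D k ω ^ 2 ∂P ≤ √K := by
    intro k
    refine Real.le_sqrt_of_sq_le ((sq_integral_le ((hDm k).pow 2)).trans ?_)
    simp_rw [← pow_mul]
    exact h4 k
  rcases isEmpty_or_nonempty (Fin ((n - 1) / 2)) with he | ⟨⟨k⟩⟩
  · have h0 : (n - 1) / 2 = 0 := by
      by_contra h
      exact he.elim ⟨0, Nat.pos_of_ne_zero h⟩
    simp [pairSum, h0]
  have hK0 : 0 ≤ K := (integral_nonneg fun ω ↦ by positivity).trans (h4 k)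
  have h := (integral_sum_pow_le hind hDm hD0 (Real.sqrt_nonneg K) h2 h4 (Real.sq_sqrt hK0).le
    Finset.univ).2
  rw [Finset.card_univ, Fintype.card_fin] at h
  refine le_of_eq_of_le ?_ h
  simp only [pairSum, D, Finset.sum_sub_distrib]

/-- The fourth moment bound for the increments of the fluctuation process, uniform in `n`. -/
lemma exists_integral_fluct_sub_pow_four_le (hb : IsBrownianFamily b P) {p : ℕ} (hp : p ≠ 0)
    (T : ℝ≥0) : ∃ C : ℝ, 0 ≤ C ∧ ∀ (n : ℕ) {s t : ℝ≥0}, s ≤ t → t ≤ T →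
      ∫ ω, (fluct P b p n t ω - fluct P b p n s ω) ^ 4 ∂P ≤ C * ((t : ℝ) - s) ^ 2 := by
  have := hb.isProbabilityMeasure
  obtain ⟨C, hC0, hC⟩ := exists_integral_norm_pow_sub_pow_le (P := P) p T
  -- `2432 = 8 (16 · 16 + 3 · 16)`: the centred real part and the pair sum, combined by `(x + y)⁴ ≤
  -- 8 (x⁴ + y⁴)`.
  refine ⟨2432 * C, by positivity, fun n s t hst htT ↦ ?_⟩
  rcases eq_or_ne n 0 with rfl | hn
  -- For `n = 0` the prefactor `1 / √0` is `0` by convention.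
  · simp only [fluct, Nat.cast_zero, Real.sqrt_zero, div_zero, zero_mul, sub_self]
    simp only [ne_eq, OfNat.ofNat_ne_zero, not_false_eq_true, zero_pow, integral_zero]
    positivity
  set h : ℝ := C * ((t : ℝ) - s) ^ 2 with hh
  have hh0 : 0 ≤ h := by positivity
  have hR := fun u ↦ hasMoments_realPart hb hn p u
  have hS := fun u ↦ hasMoments_pairSum hb n p u
  let A : Ω → ℝ := fun ω ↦ realPart p b n t ω - realPart p b n s ω
  let B : Ω → ℝ := fun ω ↦ pairSum p b n t ω - pairSum p b n s ω
  have hAm : HasMoments A P := (hR t).sub (hR s)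
  have hBm : HasMoments B P := (hS t).sub (hS s)
  have hdiff : ∀ ω, (fluct P b p n t ω - fluct P b p n s ω) ^ 4 =
      ((n : ℝ) ^ 2)⁻¹ * ((A ω - ∫ ω', A ω' ∂P) + B ω) ^ 4 := by
    intro ω
    have h1 : ∫ ω', A ω' ∂P = ∫ ω', realPart p b n t ω' ∂P - ∫ ω', realPart p b n s ω' ∂P :=
      integral_sub (hR t).integrable (hR s).integrable
    have h2 : ((√(n : ℝ))⁻¹) ^ 4 = ((n : ℝ) ^ 2)⁻¹ := by
      rw [inv_pow, show 4 = 2 * 2 by rfl, pow_mul, Real.sq_sqrt (Nat.cast_nonneg n)]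
    rw [fluct_eq hb hn hp, fluct_eq hb hn hp, h1, ← h2, ← mul_pow]
    congr 1
    simp only [A, B]
    ring
  have hA4 := integral_sub_integral_pow_four_le hAm
    (integral_realPart_sub_pow_four_le hb hn hC0 hC hst htT)
  have hB4 := integral_pairSum_sub_pow_four_le hb n hp hC hst htT
  simp_rw [hdiff]
  rw [integral_const_mul]
  have hm : (((n - 1) / 2 : ℕ) : ℝ) ≤ n := by
    exact_mod_cast (Nat.div_le_self _ _).trans (Nat.sub_le _ _)
  have hn1 : (1 : ℝ) ≤ (n : ℝ) ^ 2 :=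
    one_le_pow₀ (by exact_mod_cast Nat.one_le_iff_ne_zero.2 hn)
  have hm2 : (((n - 1) / 2 : ℕ) : ℝ) ^ 2 ≤ (n : ℝ) ^ 2 := by gcongr
  rw [inv_mul_le_iff₀ (by positivity)]
  refine (integral_add_pow_four_le (hAm.sub (HasMoments.const _)) hBm hA4 hB4).trans ?_
  rw [← hh, mul_assoc 2432 C, ← hh]
  calc 8 * (16 * (16 * h) + 3 * (((n - 1) / 2 : ℕ) : ℝ) ^ 2 * (16 * h))
      ≤ 8 * (16 * (16 * ((n : ℝ) ^ 2 * h)) + 3 * (n : ℝ) ^ 2 * (16 * h)) := by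
        gcongr
        exact le_mul_of_one_le_left hh0 hn1
    _ = _ := by ring

end FluctMoment

/-! ### Convergence of the finite dimensional distributions -/

section CLT

variable {Ω : Type*} [MeasurableSpace Ω] {P : Measure Ω}

/-- The central limit theorem along a subsequence, for characteristic functions. -/
lemma tendsto_integral_exp_sum [IsProbabilityMeasure P] {y : ℕ → Ω → ℝ} (hy : MemLp (y 0) 2 P)
    (h0 : ∫ ω, y 0 ω ∂P = 0) (hind : iIndepFun y P)
    (hid : ∀ k, IdentDistrib (y k) (y 0) P P) {r : ℕ → ℕ} (hr : Tendsto r atTop atTop)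
    {c : ℕ → ℝ} {c₀ : ℝ} (hc : Tendsto c atTop (𝓝 c₀)) :
    Tendsto (fun n ↦ ∫ ω, Complex.exp
      ((((√(r n : ℝ))⁻¹ * ∑ k ∈ Finset.range (r n), y k ω) * c n : ℝ) * Complex.I) ∂P) atTop
      (𝓝 (Complex.exp (-((∫ ω, y 0 ω ^ 2 ∂P) * c₀ ^ 2 / 2 : ℝ)))) := by
  let v := Var[y 0; P].toNNReal
  have hv : (v : ℝ) = ∫ ω, y 0 ω ^ 2 ∂P := by
    rw [Real.coe_toNNReal _ (variance_nonneg _ _),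
      variance_of_integral_eq_zero hy.aestronglyMeasurable.aemeasurable h0]
  have h := tendstoInDistribution_inv_sqrt_mul_sum_sub (P' := gaussianReal 0 v) (Y := id)
    HasLaw.id hy hind hid
  simp_rw [h0, mul_zero, sub_zero] at h
  have h' : TendstoInDistribution
      (fun n ω ↦ (√(r n : ℝ))⁻¹ * ∑ k ∈ Finset.range (r n), y k ω) atTop id (fun _ ↦ P)
      (gaussianReal 0 v) :=
    ⟨fun n ↦ h.forall_aemeasurable (r n), h.aemeasurable_limit, h.tendsto.comp hr⟩
  -- Slutsky's theorem with a deterministic factor, which corrects the normalisation from `√(r n)`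
  -- to that of the fluctuation.
  have h2 := h'.continuous_comp_prodMk_of_tendstoInMeasure_const (g := fun x : ℝ × ℝ ↦ x.1 * x.2)
    (Y := fun n _ ↦ c n) (c := c₀) (by fun_prop)
    (tendstoInMeasure_of_tendsto_ae (fun n ↦ aestronglyMeasurable_const) (ae_of_all _ fun _ ↦ hc))
    (fun n ↦ aemeasurable_const)
  have h3 := ProbabilityMeasure.tendsto_iff_tendsto_charFun.1 h2.tendsto 1
  have hm : Measure.map (fun ω : ℝ ↦ id ω * c₀) (gaussianReal 0 v) =
      gaussianReal 0 (NNReal.mk (c₀ ^ 2) (sq_nonneg c₀) * v) := by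
    rw [show (fun ω : ℝ ↦ id ω * c₀) = (fun ω ↦ ω * c₀) from rfl, gaussianReal_map_mul_const,
      mul_zero]
  have hlim : charFun (gaussianReal 0 (NNReal.mk (c₀ ^ 2) (sq_nonneg c₀) * v)) 1 =
      Complex.exp (-((∫ ω, y 0 ω ^ 2 ∂P) * c₀ ^ 2 / 2 : ℝ)) := by
    have h4 : ((NNReal.mk (c₀ ^ 2) (sq_nonneg c₀) * v : ℝ≥0) : ℂ) = (c₀ : ℂ) ^ 2 * (v : ℝ) := by
      rw [NNReal.coe_mul, NNReal.coe_mk]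
      push_cast
      rfl
    rw [charFun_gaussianReal, ← hv, h4]
    congr 1
    push_cast
    ring
  simp only [ProbabilityMeasure.coe_mk] at h3
  rw [hm, hlim] at h3
  refine h3.congr fun n ↦ ?_
  rw [charFun_apply_real, integral_map (h2.forall_aemeasurable n) (by fun_prop)]
  simp

/-- From `|exp(ix) - 1| ≤ |x|`: an `L¹`-small summand may be dropped from a characteristic function
without any independence. -/
lemma norm_integral_exp_add_sub_le [IsProbabilityMeasure P] {A B : Ω → ℝ} (hA : Integrable A P)
    (hB : AEMeasurable B P) :
    ‖∫ ω, Complex.exp ((A ω + B ω : ℝ) * Complex.I) ∂P -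
      ∫ ω, Complex.exp ((B ω : ℝ) * Complex.I) ∂P‖ ≤ ∫ ω, |A ω| ∂P := by
  have hint : ∀ {C : Ω → ℝ}, AEMeasurable C P →
      Integrable (fun ω ↦ Complex.exp ((C ω : ℝ) * Complex.I)) P := by
    intro C hC
    refine Integrable.of_bound (C := 1) (by fun_prop) (ae_of_all _ fun ω ↦ ?_)
    rw [Complex.norm_exp_ofReal_mul_I]
  have hAB : Integrable (fun ω ↦ Complex.exp ((A ω + B ω : ℝ) * Complex.I)) P :=
    hint (hA.aemeasurable.add hB)
  rw [← integral_sub hAB (hint hB)]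
  refine norm_integral_le_of_norm_le hA.abs (ae_of_all _ fun ω ↦ ?_)
  have h1 : Complex.exp ((A ω + B ω : ℝ) * Complex.I) - Complex.exp ((B ω : ℝ) * Complex.I) =
      Complex.exp ((B ω : ℝ) * Complex.I) * (Complex.exp (Complex.I * (A ω : ℝ)) - 1) := by
    rw [mul_sub, ← Complex.exp_add, mul_one]
    congr 2
    push_cast
    ring
  rw [h1, norm_mul, Complex.norm_exp_ofReal_mul_I, one_mul]
  exact Real.norm_exp_I_mul_ofReal_sub_one_le

lemma integral_sum_mul_sq {Z : ℝ≥0 → Ω → ℝ} (hZ : ∀ t, MemLp (Z t) 2 P) (I : Finset ℝ≥0)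
    (w : ℝ≥0 → ℝ) {v : ℝ≥0 → ℝ≥0 → ℝ} (hv : ∀ s t, ∫ ω, Z s ω * Z t ω ∂P = v s t) :
    ∫ ω, (∑ t ∈ I, w t * Z t ω) ^ 2 ∂P = ∑ s ∈ I, ∑ t ∈ I, w s * w t * v s t := by
  have hint : ∀ s t, Integrable (fun ω ↦ w s * w t * (Z s ω * Z t ω)) P := fun s t ↦
    ((hZ s).integrable_mul (hZ t)).const_mul _
  have h1 : ∀ ω, (∑ t ∈ I, w t * Z t ω) ^ 2 =
      ∑ s ∈ I, ∑ t ∈ I, w s * w t * (Z s ω * Z t ω) := by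
    intro ω
    rw [sq, Finset.sum_mul_sum]
    refine Finset.sum_congr rfl fun s _ ↦ Finset.sum_congr rfl fun t _ ↦ ?_
    ring
  simp_rw [h1]
  rw [integral_finsetSum _ fun s _ ↦ integrable_finsetSum _ fun t _ ↦ hint s t]
  refine Finset.sum_congr rfl fun s _ ↦ ?_
  rw [integral_finsetSum _ fun t _ ↦ hint s t]
  refine Finset.sum_congr rfl fun t _ ↦ ?_
  rw [integral_const_mul, hv]

/-- The characteristic function of the finite dimensional marginals of a centred Gaussian
process. -/
lemma integral_exp_sum_of_isGaussianProcess {Z : ℝ≥0 → Ω → ℝ} (hZ : IsGaussianProcess Z P)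
    (h0 : ∀ t, ∫ ω, Z t ω ∂P = 0) {v : ℝ≥0 → ℝ≥0 → ℝ}
    (hv : ∀ s t, ∫ ω, Z s ω * Z t ω ∂P = v s t) (I : Finset ℝ≥0) (w : ℝ≥0 → ℝ) :
    ∫ ω, Complex.exp ((∑ t ∈ I, w t * Z t ω : ℝ) * Complex.I) ∂P =
      Complex.exp (-((∑ s ∈ I, ∑ t ∈ I, w s * w t * v s t) / 2 : ℝ)) := by
  have hm : ∀ t, MemLp (Z t) 2 P := fun t ↦ (hZ.hasGaussianLaw_eval t).memLp (by simp)
  have := hZ.isProbabilityMeasure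
  let S : Ω → ℝ := fun ω ↦ ∑ t ∈ I, w t * Z t ω
  have hS : HasGaussianLaw S P := (hZ.smul w).hasGaussianLaw_fun_sum
  have hS0 : ∫ ω, S ω ∂P = 0 := by
    simp only [S]
    rw [integral_finsetSum _ fun t _ ↦ ((hm t).integrable (by simp)).const_mul _]
    simp_rw [integral_const_mul, h0, mul_zero, Finset.sum_const_zero]
  have hS2 : Var[S; P] = ∑ s ∈ I, ∑ t ∈ I, w s * w t * v s t := by
    rw [variance_of_integral_eq_zero hS.aemeasurable hS0]
    exact integral_sum_mul_sq hm I w hv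
  have h1 : ∫ ω, Complex.exp ((S ω : ℝ) * Complex.I) ∂P = charFun (P.map S) 1 := by
    rw [charFun_apply_real, integral_map hS.aemeasurable (by fun_prop)]
    simp
  refine h1.trans ?_
  rw [hS.map_eq_gaussianReal, hS0, charFun_gaussianReal, ← hS2]
  congr 1
  have h2 : (Var[S; P].toNNReal : ℝ) = Var[S; P] := Real.coe_toNNReal _ (variance_nonneg _ _)
  rw [show ((Var[S; P].toNNReal : ℝ≥0) : ℂ) = ((Var[S; P].toNNReal : ℝ) : ℂ) from rfl, h2]
  push_cast
  ring

end CLT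

/-! ### The central limit theorem for the sum over conjugate pairs. -/

section FiniteDimensional

variable {Ω : Type*} [MeasurableSpace Ω] {P : Measure Ω} {b : ℕ → ℝ≥0 → Ω → ℝ}

/-- Linear combination of the values of `pairTerm`. -/
noncomputable def pairComb (p : ℕ) (I : Finset ℝ≥0) (w : ℝ≥0 → ℝ) (X : Fin 2 → ℝ≥0 → Ω → ℝ)
    (ω : Ω) : ℝ :=
  ∑ t ∈ I, w t * pairTerm p X t ω

lemma measurable_pairComb_eval (p : ℕ) (I : Finset ℝ≥0) (w : ℝ≥0 → ℝ) :
    Measurable fun x : Fin 2 × ℝ≥0 → ℝ ↦ pairComb p I w (fun c t x ↦ x (c, t)) x :=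
  Finset.measurable_fun_sum _ fun t _ ↦ (measurable_pairTerm_eval p t).const_mul _

lemma pairComb_congr {Ω Ω' : Type*} (p : ℕ) (I : Finset ℝ≥0) (w : ℝ≥0 → ℝ)
    {X : Fin 2 → ℝ≥0 → Ω → ℝ} {Y : Fin 2 → ℝ≥0 → Ω' → ℝ} {ω : Ω} {ω' : Ω'}
    (h : ∀ c t, X c t ω = Y c t ω') : pairComb p I w X ω = pairComb p I w Y ω' := by
  simp only [pairComb, pairTerm, complexBM, complexComb, h]

lemma measurable_pairComb_eval_family {κ : Type*} (p : ℕ) (I : Finset ℝ≥0) (w : ℝ≥0 → ℝ) (k : κ) :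
    Measurable fun x : κ × Fin 2 → ℝ≥0 → ℝ ↦ pairComb p I w (fun c t x ↦ x (k, c) t) x := by
  have h : Measurable fun (x : κ × Fin 2 → ℝ≥0 → ℝ) (q : Fin 2 × ℝ≥0) ↦ x (k, q.1) q.2 := by
    fun_prop
  have h1 : (fun x : κ × Fin 2 → ℝ≥0 → ℝ ↦ pairComb p I w (fun c t x ↦ x (k, c) t) x) =
      (fun x ↦ pairComb p I w (fun c t (x : Fin 2 × ℝ≥0 → ℝ) ↦ x (c, t)) x) ∘
        fun x q ↦ x (k, q.1) q.2 :=
    funext fun x ↦ pairComb_congr p I w fun _ _ ↦ rfl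
  rw [h1]
  exact (measurable_pairComb_eval p I w).comp h

lemma hasMoments_pairComb {X : Fin 2 → ℝ≥0 → Ω → ℝ} (hX : IsBrownianFamily X P) (p : ℕ)
    (I : Finset ℝ≥0) (w : ℝ≥0 → ℝ) : HasMoments (pairComb p I w X) P :=
  HasMoments.sum fun t _ ↦ (hasMoments_pairTerm hX p t).const_mul _

lemma integral_pairComb {X : Fin 2 → ℝ≥0 → Ω → ℝ} (hX : IsBrownianFamily X P) {p : ℕ}
    (hp : p ≠ 0) (I : Finset ℝ≥0) (w : ℝ≥0 → ℝ) : ∫ ω, pairComb p I w X ω ∂P = 0 := by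
  unfold pairComb
  rw [integral_finsetSum _ fun t _ ↦ ((hasMoments_pairTerm hX p t).const_mul _).integrable]
  simp_rw [integral_const_mul, integral_pairTerm hX hp, mul_zero, Finset.sum_const_zero]

lemma integral_pairComb_sq {X : Fin 2 → ℝ≥0 → Ω → ℝ} (hX : IsBrownianFamily X P) {p : ℕ}
    (hp : p ≠ 0) (I : Finset ℝ≥0) (w : ℝ≥0 → ℝ) : ∫ ω, pairComb p I w X ω ^ 2 ∂P =
      ∑ s ∈ I, ∑ t ∈ I, w s * w t * (2 * p ! * ((min s t : ℝ≥0) : ℝ) ^ p) :=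
  integral_sum_mul_sq (fun t ↦ hasMoments_pairTerm hX p t 2) I w (integral_pairTerm_mul hX hp)

/-- Disjoint pairs of the given Brownian motions. -/
def pairs (b : ℕ → ℝ≥0 → Ω → ℝ) (q : ℕ × Fin 2) : ℝ≥0 → Ω → ℝ := b (2 * q.1 + q.2)

lemma isBrownianFamily_pairs (hb : IsBrownianFamily b P) : IsBrownianFamily (pairs b) P := by
  refine hb.comp_injective fun q r h ↦ ?_
  have h1 := q.2.2
  have h2 := r.2.2
  refine Prod.ext ?_ (Fin.ext ?_) <;> omega

lemma isBrownianFamily_pairs_apply (hb : IsBrownianFamily b P) (k : ℕ) :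
    IsBrownianFamily (fun c ↦ pairs b (k, c)) P :=
  (isBrownianFamily_pairs hb).comp_injective fun c d h ↦ by simpa using h

lemma identDistrib_pairComb {X Y : Fin 2 → ℝ≥0 → Ω → ℝ} (hX : IsBrownianFamily X P)
    (hY : IsBrownianFamily Y P) (p : ℕ) (I : Finset ℝ≥0) (w : ℝ≥0 → ℝ) :
    IdentDistrib (pairComb p I w X) (pairComb p I w Y) P P := by
  have h : Measurable fun (x : Fin 2 → ℝ≥0 → ℝ) (q : Fin 2 × ℝ≥0) ↦ x q.1 q.2 := by
    fun_prop
  exact (hX.identDistrib hY).comp ((measurable_pairComb_eval p I w).comp h)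

lemma iIndepFun_pairComb {κ : Type*} {X : κ × Fin 2 → ℝ≥0 → Ω → ℝ} (hX : IsBrownianFamily X P)
    (p : ℕ) (I : Finset ℝ≥0) (w : ℝ≥0 → ℝ) :
    iIndepFun (fun k ↦ pairComb p I w (fun c ↦ X (k, c))) P := by
  have h : (fun k ↦ pairComb p I w (fun c ↦ X (k, c))) = fun k ↦
      (fun x : Fin 2 × ℝ≥0 → ℝ ↦ pairComb p I w (fun c t x ↦ x (c, t)) x) ∘
        fun ω q ↦ X (k, q.1) q.2 ω :=
    funext fun k ↦ funext fun ω ↦ pairComb_congr p I w fun _ _ ↦ rfl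
  rw [h]
  exact hX.indep_blocks.comp _ fun _ ↦ measurable_pairComb_eval p I w

/-- The eigenvalue pairs form a triangular array. In law, its `n`-th row sum is a partial sum of one
fixed i.i.d. sequence, so the classical central limit theorem applies. -/
lemma identDistrib_sum_pairComb (hb : IsBrownianFamily b P) (n p : ℕ) (I : Finset ℝ≥0)
    (w : ℝ≥0 → ℝ) :
    IdentDistrib (fun ω ↦ ∑ k, pairComb p I w (fun c ↦ pairBM b n (k, c)) ω)
      (fun ω ↦ ∑ k ∈ Finset.range ((n - 1) / 2), pairComb p I w (fun c ↦ pairs b (k, c)) ω)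
      P P := by
  have hY : IsBrownianFamily (fun q : Fin ((n - 1) / 2) × Fin 2 ↦ pairs b (q.1, q.2)) P :=
    (isBrownianFamily_pairs hb).comp_injective
      (g := fun q : Fin ((n - 1) / 2) × Fin 2 ↦ ((q.1 : ℕ), q.2)) fun q r h ↦ by
      simp only [Prod.mk.injEq] at h
      exact Prod.ext (Fin.ext h.1) h.2
  have h := ((isBrownianFamily_pairBM hb n).identDistrib hY).comp
    (Finset.measurable_fun_sum Finset.univ fun k _ ↦ measurable_pairComb_eval_family p I w k)
  simp_rw [← Fin.sum_univ_eq_sum_range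
    (fun k ↦ pairComb p I w (fun c ↦ pairs b (k, c)) _)]
  exact h

lemma tendsto_half : Tendsto (fun n : ℕ ↦ (n - 1) / 2) atTop atTop := by
  refine tendsto_atTop.2 fun m ↦ ?_
  filter_upwards [eventually_ge_atTop (2 * m + 1)] with n hn
  omega

lemma tendsto_sqrt_half_div :
    Tendsto (fun n : ℕ ↦ √((((n - 1) / 2 : ℕ) : ℝ)) / √(n : ℝ)) atTop (𝓝 (√(1 / 2))) := by
  simp_rw [← Real.sqrt_div' _ (Nat.cast_nonneg _)]
  refine (Real.continuous_sqrt.tendsto _).comp ?_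
  have h1 : Tendsto (fun n : ℕ ↦ 1 / 2 - 1 / (n : ℝ)) atTop (𝓝 (1 / 2)) := by
    simpa using tendsto_one_div_atTop_nhds_zero_nat.const_sub (1 / 2 : ℝ)
  refine tendsto_of_tendsto_of_tendsto_of_le_of_le' h1 tendsto_const_nhds ?_ ?_
  · filter_upwards [eventually_ge_atTop 1] with n hn
    have hn' : (0 : ℝ) < n := by exact_mod_cast hn
    have h2 : (n : ℝ) ≤ 2 * ((n - 1) / 2 : ℕ) + 2 := by
      exact_mod_cast (by omega : n ≤ 2 * ((n - 1) / 2) + 2)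
    rw [le_div_iff₀ hn', sub_mul, one_div_mul_cancel hn'.ne']
    linarith
  · filter_upwards [eventually_ge_atTop 1] with n hn
    have hn' : (0 : ℝ) < n := by exact_mod_cast hn
    have h2 : 2 * (((n - 1) / 2 : ℕ) : ℝ) ≤ n := by
      exact_mod_cast (by omega : 2 * ((n - 1) / 2) ≤ n)
    rw [div_le_iff₀ hn']
    linarith

lemma integral_realPart_sq_le (hb : IsBrownianFamily b P) {n : ℕ} (hn : n ≠ 0) (p : ℕ)
    (t : ℝ≥0) :
    ∫ ω, realPart p b n t ω ^ 2 ∂P ≤ 4 * (((2 * p - 1)‼ : ℕ) * (t : ℝ) ^ p) := by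
  have := hb.isProbabilityMeasure
  have h0 := isBrownianReal_realBM hb hn (e := 0) (by simp)
  have hA := integral_pow_of_isBrownianReal h0 t p
  have hK : 0 ≤ (((2 * p - 1)‼ : ℕ) : ℝ) * (t : ℝ) ^ p := by positivity
  have hm0 := (IsBrownianReal.hasMoments h0 t).pow (2 * p)
  unfold realPart
  split_ifs with he
  · have h1 := isBrownianReal_realBM hb hn (e := n / 2) (by rw [Nat.mul_div_cancel' he.two_dvd])
    have hB := integral_pow_of_isBrownianReal h1 t p
    have hm1 := (IsBrownianReal.hasMoments h1 t).pow (2 * p)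
    have hm := ((IsBrownianReal.hasMoments h0 t).pow p).add
      ((IsBrownianReal.hasMoments h1 t).pow p)
    calc _ ≤ ∫ ω, 2 * (realBM b n 0 t ω ^ (2 * p) + realBM b n (n / 2) t ω ^ (2 * p)) ∂P := by
          refine integral_mono (hm.pow 2).integrable ((hm0.add hm1).const_mul 2).integrable
            fun ω ↦ ?_
          simp only
          rw [mul_comm 2 p, pow_mul, pow_mul]
          exact add_sq_le
      _ = _ := by
          rw [integral_const_mul, integral_add hm0.integrable hm1.integrable, hA, hB]
          ring
  · simp_rw [add_zero, ← pow_mul, mul_comm p 2, hA]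
    linarith

/-- From `|x| ≤ 1 + x²`; what matters is that the bound does not depend on `n`. -/
lemma integral_abs_realPart_sub_le (hb : IsBrownianFamily b P) {n : ℕ} (hn : n ≠ 0) (p : ℕ)
    (t : ℝ≥0) :
    ∫ ω, |realPart p b n t ω - ∫ ω', realPart p b n t ω' ∂P| ∂P ≤
      1 + 4 * (((2 * p - 1)‼ : ℕ) * (t : ℝ) ^ p) := by
  have := hb.isProbabilityMeasure
  have hm := hasMoments_realPart hb hn p t
  have hd : HasMoments (fun ω ↦ realPart p b n t ω - ∫ ω', realPart p b n t ω' ∂P) P :=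
    hm.sub (HasMoments.const _)
  have hv : ∫ ω, (realPart p b n t ω - ∫ ω', realPart p b n t ω' ∂P) ^ 2 ∂P ≤
      ∫ ω, realPart p b n t ω ^ 2 ∂P := by
    rw [← variance_eq_integral hm.aestronglyMeasurable.aemeasurable]
    exact variance_le_expectation_sq hm.aestronglyMeasurable
  calc _ ≤ ∫ ω, (1 + (realPart p b n t ω - ∫ ω', realPart p b n t ω' ∂P) ^ 2) ∂P := by
        refine integral_mono hd.integrable.abs ((HasMoments.const 1).add (hd.pow 2)).integrable
          fun ω ↦ ?_
        simp only
        rw [← sq_abs]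
        nlinarith [sq_nonneg (|realPart p b n t ω - ∫ ω', realPart p b n t ω' ∂P| - 1)]
    _ ≤ _ := by
        rw [integral_add (HasMoments.const 1).integrable (hd.pow 2).integrable, integral_const,
          probReal_univ, one_smul]
        linarith [integral_realPart_sq_le hb hn p t]

/-- Convergence of the characteristic functions of the finite dimensional marginals of the
fluctuation process. -/
lemma tendsto_integral_exp_fluct (hb : IsBrownianFamily b P) {p : ℕ} (hp : p ≠ 0)
    (I : Finset ℝ≥0) (w : ℝ≥0 → ℝ) :
    Tendsto (fun n ↦ ∫ ω, Complex.exp ((∑ t ∈ I, w t * fluct P b p n t ω : ℝ) * Complex.I) ∂P)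
      atTop (𝓝 (Complex.exp
        (-((∑ s ∈ I, ∑ t ∈ I, w s * w t * (((min s t : ℝ≥0) : ℝ) ^ p * p !)) / 2 : ℝ)))) := by
  have := hb.isProbabilityMeasure
  let y : ℕ → Ω → ℝ := fun k ↦ pairComb p I w (fun c ↦ pairs b (k, c))
  have hyf := isBrownianFamily_pairs_apply hb
  have hyind : iIndepFun y P := iIndepFun_pairComb (isBrownianFamily_pairs hb) p I w
  have hy2 : MemLp (y 0) 2 P := hasMoments_pairComb (hyf 0) p I w 2
  have hy0 : ∫ ω, y 0 ω ∂P = 0 := integral_pairComb (hyf 0) hp I w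
  have hyid : ∀ k, IdentDistrib (y k) (y 0) P P := fun k ↦
    identDistrib_pairComb (hyf k) (hyf 0) p I w
  have hclt := tendsto_integral_exp_sum hy2 hy0 hyind hyid tendsto_half tendsto_sqrt_half_div
  -- The factor `2` in the covariance of a pair cancels against the `1/2` from the number of pairs
  -- per dimension.
  have hvar : (∫ ω, y 0 ω ^ 2 ∂P) * √(1 / 2) ^ 2 / 2 =
      (∑ s ∈ I, ∑ t ∈ I, w s * w t * (((min s t : ℝ≥0) : ℝ) ^ p * p !)) / 2 := by
    rw [integral_pairComb_sq (hyf 0) hp, Real.sq_sqrt (by norm_num), Finset.sum_mul]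
    congr 1
    refine Finset.sum_congr rfl fun s _ ↦ ?_
    rw [Finset.sum_mul]
    refine Finset.sum_congr rfl fun t _ ↦ ?_
    ring
  rw [hvar] at hclt
  let A : ℕ → Ω → ℝ := fun n ω ↦ (√(n : ℝ))⁻¹ *
    ∑ t ∈ I, w t * (realPart p b n t ω - ∫ ω', realPart p b n t ω' ∂P)
  let B : ℕ → Ω → ℝ := fun n ω ↦ (√(n : ℝ))⁻¹ *
    ∑ k, pairComb p I w (fun c ↦ pairBM b n (k, c)) ω
  have hBid : ∀ n, ∫ ω, Complex.exp ((B n ω : ℝ) * Complex.I) ∂P =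
      ∫ ω, Complex.exp ((((√((((n - 1) / 2 : ℕ) : ℝ)))⁻¹ *
        ∑ k ∈ Finset.range ((n - 1) / 2), y k ω) *
        (√((((n - 1) / 2 : ℕ) : ℝ)) / √(n : ℝ)) : ℝ) * Complex.I) ∂P := by
    intro n
    have h1 : Measurable fun x : ℝ ↦ Complex.exp (((√(n : ℝ))⁻¹ * x : ℝ) * Complex.I) := by
      fun_prop
    refine ((identDistrib_sum_pairComb hb n p I w).comp h1).integral_eq.trans ?_
    refine integral_congr_ae (ae_of_all _ fun ω ↦ ?_)
    simp only [Function.comp_apply]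
    congr 3
    rcases Nat.eq_zero_or_pos ((n - 1) / 2) with h0 | h0
    · simp [h0]
    · have h2 : √((((n - 1) / 2 : ℕ) : ℝ)) ≠ 0 := (Real.sqrt_pos.2 (by exact_mod_cast h0)).ne'
      field_simp
      rfl
  simp_rw [← hBid] at hclt
  have hsplit : ∀ n, n ≠ 0 → ∀ ω, ∑ t ∈ I, w t * fluct P b p n t ω = A n ω + B n ω := by
    intro n hn ω
    simp only [A, B, pairComb]
    rw [Finset.sum_comm, ← mul_add, ← Finset.sum_add_distrib, Finset.mul_sum]
    refine Finset.sum_congr rfl fun t _ ↦ ?_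
    rw [fluct_eq hb hn hp, pairSum, ← Finset.mul_sum]
    ring
  let K : ℝ := ∑ t ∈ I, |w t| * (1 + 4 * (((2 * p - 1)‼ : ℕ) * (t : ℝ) ^ p))
  have hAt : ∀ n, n ≠ 0 → ∀ t, HasMoments
      (fun ω ↦ w t * (realPart p b n t ω - ∫ ω', realPart p b n t ω' ∂P)) P := fun n hn t ↦
    ((hasMoments_realPart hb hn p t).sub (HasMoments.const _)).const_mul _
  have hA : ∀ n, n ≠ 0 → HasMoments (A n) P := fun n hn ↦
    (HasMoments.sum fun t _ ↦ hAt n hn t).const_mul _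
  have hAbound : ∀ n, n ≠ 0 → ∫ ω, |A n ω| ∂P ≤ (√(n : ℝ))⁻¹ * K := by
    intro n hn
    have hi : ∀ t, Integrable (fun ω ↦ |w t| *
        |realPart p b n t ω - ∫ ω', realPart p b n t ω' ∂P|) P := fun t ↦
      (((hasMoments_realPart hb hn p t).sub (HasMoments.const _)).integrable.abs).const_mul _
    calc ∫ ω, |A n ω| ∂P ≤ ∫ ω, (√(n : ℝ))⁻¹ * ∑ t ∈ I, |w t| *
          |realPart p b n t ω - ∫ ω', realPart p b n t ω' ∂P| ∂P := by
          refine integral_mono (hA n hn).integrable.abs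
            ((integrable_finsetSum _ fun t _ ↦ hi t).const_mul _) fun ω ↦ ?_
          simp only [A]
          rw [abs_mul, abs_of_nonneg (by positivity : 0 ≤ (√(n : ℝ))⁻¹)]
          gcongr
          refine (Finset.abs_sum_le_sum_abs _ _).trans (Finset.sum_le_sum fun t _ ↦ ?_)
          rw [abs_mul]
      _ ≤ _ := by
          rw [integral_const_mul, integral_finsetSum _ fun t _ ↦ hi t]
          simp_rw [integral_const_mul]
          simp only [K]
          gcongr with t ht
          exact integral_abs_realPart_sub_le hb hn p t
  have hlim0 : Tendsto (fun n : ℕ ↦ (√(n : ℝ))⁻¹ * K) atTop (𝓝 0) := by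
    have h1 : Tendsto (fun n : ℕ ↦ √(n : ℝ)) atTop atTop :=
      Real.tendsto_sqrt_atTop.comp tendsto_natCast_atTop_atTop
    simpa using h1.inv_tendsto_atTop.mul_const K
  have hdiff : Tendsto (fun n ↦
      ∫ ω, Complex.exp ((∑ t ∈ I, w t * fluct P b p n t ω : ℝ) * Complex.I) ∂P -
        ∫ ω, Complex.exp ((B n ω : ℝ) * Complex.I) ∂P) atTop (𝓝 0) := by
    refine squeeze_zero_norm' ?_ hlim0
    filter_upwards [eventually_ne_atTop 0] with n hn
    simp_rw [hsplit n hn]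
    refine (norm_integral_exp_add_sub_le (hA n hn).integrable ?_).trans (hAbound n hn)
    exact ((HasMoments.sum fun k _ ↦ hasMoments_pairComb (isBrownianFamily_pair hb k) p I
      w).const_mul _).aestronglyMeasurable.aemeasurable
  simpa using hdiff.add hclt

end FiniteDimensional

/-! ### The limit process -/

/-- The numbers `f p k`, `k < p`, sum to one. -/
lemma sum_range_f {p : ℕ} (hp : p ≠ 0) : ∑ k ∈ Finset.range p, f p k = 1 := by
  obtain ⟨q, rfl⟩ := Nat.exists_eq_succ_of_ne_zero hp
  simp only [Nat.succ_eq_add_one, f, Nat.add_sub_cancel]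
  rw [← Finset.mul_sum]
  -- With `p = q + 1`, substitute `a = s - k` so that the power no longer depends on `s`, then
  -- exchange the sums. The partial alternating sums of `(q + 1).choose k` are `± q.choose a`, and
  -- the total is the `q`-th forward difference of `x ^ q` at `0`, namely `q!`.
  have h1 : ∀ s : ℕ, ∑ k ∈ Finset.range (s + 1), (-1 : ℝ) ^ k * ((q + 1).choose k : ℝ) *
      ((s : ℝ) - k) ^ q =
      ∑ a ∈ Finset.range (s + 1), (-1 : ℝ) ^ (s - a) * ((q + 1).choose (s - a) : ℝ) *
        (a : ℝ) ^ q := by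
    intro s
    rw [← Finset.sum_flip]
    refine Finset.sum_congr rfl fun a ha ↦ ?_
    rw [Finset.mem_range] at ha
    rw [Nat.cast_sub (by omega : a ≤ s)]
    congr 2
    ring
  have h2 : ∀ a ∈ Finset.range (q + 1), ∑ k ∈ Finset.range (q + 1 - a),
      (-1 : ℝ) ^ k * ((q + 1).choose k : ℝ) * (a : ℝ) ^ q =
      ((-1 : ℤ) ^ (q - a) * (q.choose a : ℤ)) • ((0 : ℝ) + a • (1 : ℝ)) ^ q := by
    intro a ha
    rw [Finset.mem_range] at ha
    rw [← Finset.sum_mul, show q + 1 - a = q - a + 1 by omega]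
    have h3 := congrArg (Int.cast : ℤ → ℝ)
      (Int.alternating_sum_range_choose_eq_choose (n := q) (m := q - a))
    push_cast at h3
    rw [h3, Nat.choose_symm (by omega : a ≤ q)]
    simp
  simp_rw [h1]
  rw [Finset.sum_range_diag_flip (q + 1)
      (fun a k ↦ (-1 : ℝ) ^ k * ((q + 1).choose k : ℝ) * (a : ℝ) ^ q),
    Finset.sum_congr rfl h2,
    ← fwdDiff_iter_eq_sum_shift (1 : ℝ) (fun r : ℝ ↦ r ^ q) q 0, fwdDiff_iter_eq_factorial]
  have : (q ! : ℝ) ≠ 0 := by exact_mod_cast q.factorial_ne_zero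
  simp [this]

/-! ### Existence of the limit process and its law on path space. -/

section LimitProcess

variable {Ω : Type*} [MeasurableSpace Ω] {P : Measure Ω}

/-- Since `t ↦ tᵖ` is increasing, the time change turns the covariance `min` into `min(s,t)ᵖ`. -/
lemma IsLimitProcess.of_isBrownianReal {B : ℝ≥0 → Ω → ℝ} (hB : IsBrownianReal B P) {p : ℕ}
    (hp : p ≠ 0) : IsLimitProcess p (fun t ω ↦ √(p ! : ℝ) * B (t ^ p) ω) P where
  gaussian := (hB.isGaussianProcess.comp_right fun t : ℝ≥0 ↦ t ^ p).smul fun _ ↦ √(p ! : ℝ)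
  continuous_paths := by
    filter_upwards [hB.cont] with ω hω
    exact (hω.comp (continuous_pow p)).const_mul _
  mean_zero t := by
    rw [integral_const_mul, hB.integral_eval, mul_zero]
  covariance s t := by
    have := hB.isGaussianProcess.isProbabilityMeasure
    have hm := fun t ↦ IsBrownianReal.hasMoments hB t 2
    have h1 := hB.covariance_eval (s ^ p) (t ^ p)
    rw [covariance_eq_sub (hm _) (hm _), hB.integral_eval, zero_mul, sub_zero] at h1
    have h2 : ∀ ω, √(p ! : ℝ) * B (s ^ p) ω * (√(p ! : ℝ) * B (t ^ p) ω) =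
        p ! * (B (s ^ p) * B (t ^ p)) ω := by
      intro ω
      rw [mul_mul_mul_comm, Real.mul_self_sqrt (Nat.cast_nonneg _), Pi.mul_apply]
    have h3 : min (s ^ p) (t ^ p) = min s t ^ p :=
      ((pow_left_mono p).map_min (a := s) (b := t)).symm
    simp_rw [h2]
    rw [integral_const_mul, h1, h3, sum_range_f hp, mul_one, mul_comm]
    push_cast
    rfl

/-- The coordinate process under the law of a limit process is a limit process. -/
lemma IsLimitProcess.map_path {p : ℕ} {N : ℝ≥0 → Ω → ℝ} (hN : IsLimitProcess p N P) :
    IsLimitProcess p (fun t (x : C(ℝ≥0, ℝ)) ↦ x t) (P.map (path N)) := by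
  have hpath : AEMeasurable (path N) P :=
    aemeasurable_path hN.gaussian.aemeasurable hN.continuous_paths
  have hae : ∀ᵐ ω ∂P, ∀ t, path N ω t = N t ω := by
    filter_upwards [hN.continuous_paths] with ω hω t using path_apply hω t
  refine ⟨⟨fun I ↦ ⟨?_⟩⟩, ae_of_all _ fun x ↦ x.continuous, fun t ↦ ?_, fun s t ↦ ?_⟩
  · have hI : Measurable fun x : C(ℝ≥0, ℝ) ↦ I.restrict fun t ↦ x t :=
      measurable_pi_lambda _ fun t ↦ measurable_eval t
    rw [AEMeasurable.map_map_of_aemeasurable hI.aemeasurable hpath]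
    have h1 : ((fun x : C(ℝ≥0, ℝ) ↦ I.restrict fun t ↦ x t) ∘ path N) =ᵐ[P]
        fun ω ↦ I.restrict (N · ω) := by
      filter_upwards [hae] with ω hω
      ext t
      exact hω t
    rw [Measure.map_congr h1]
    exact (hN.gaussian.hasGaussianLaw I).isGaussian_map
  · rw [integral_map hpath (measurable_eval t).aestronglyMeasurable, ← hN.mean_zero t]
    refine integral_congr_ae ?_
    filter_upwards [hae] with ω hω using hω t
  · have hst : Measurable fun x : C(ℝ≥0, ℝ) ↦ x s * x t :=
      (measurable_eval s).mul (measurable_eval t)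
    rw [integral_map hpath hst.aestronglyMeasurable, ← hN.covariance s t]
    refine integral_congr_ae ?_
    filter_upwards [hae] with ω hω
    rw [hω, hω]

end LimitProcess

/-! ### Path properties of the fluctuation process and the convergence. -/

section Paths

variable {Ω : Type*} [MeasurableSpace Ω] {P : Measure Ω} {b : ℕ → ℝ≥0 → Ω → ℝ}

/-- By Brownian scaling each mean is a constant times `√t ^ p`, so the centring does not destroy
path continuity. -/
lemma continuous_integral_realPart (hb : IsBrownianFamily b P) {n : ℕ} (hn : n ≠ 0) (p : ℕ) :
    Continuous fun t ↦ ∫ ω, realPart p b n t ω ∂P := by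
  have hpow : ∀ {X : ℝ≥0 → Ω → ℝ}, IsBrownianReal X P →
      Continuous fun t ↦ ∫ ω, X t ω ^ p ∂P := by
    intro X hX
    simp_rw [integral_pow_eq_sqrt_pow_mul hX]
    fun_prop
  have h0 := isBrownianReal_realBM hb hn (e := 0) (by simp)
  have := hb.isProbabilityMeasure
  unfold realPart
  split_ifs with he
  · have h1 := isBrownianReal_realBM hb hn (e := n / 2) (by rw [Nat.mul_div_cancel' he.two_dvd])
    have h2 : ∀ t, ∫ ω, (realBM b n 0 t ω ^ p + realBM b n (n / 2) t ω ^ p) ∂P =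
        ∫ ω, realBM b n 0 t ω ^ p ∂P + ∫ ω, realBM b n (n / 2) t ω ^ p ∂P := fun t ↦
      integral_add ((IsBrownianReal.hasMoments h0 t).pow p).integrable
        ((IsBrownianReal.hasMoments h1 t).pow p).integrable
    simp_rw [h2]
    exact (hpow h0).add (hpow h1)
  · simp_rw [add_zero]
    exact hpow h0

lemma ae_continuous_fluct (hb : IsBrownianFamily b P) {p : ℕ} (hp : p ≠ 0) (n : ℕ) :
    ∀ᵐ ω ∂P, Continuous fun t ↦ fluct P b p n t ω := by
  rcases eq_or_ne n 0 with rfl | hn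
  · refine ae_of_all _ fun ω ↦ ?_
    simp only [fluct, Nat.cast_zero, Real.sqrt_zero, div_zero, zero_mul]
    exact continuous_const
  have h : ∀ᵐ ω ∂P, ∀ i, Continuous fun t ↦ b i t ω := ae_all_iff.2 fun i ↦ (hb.brownian i).cont
  filter_upwards [h] with ω hω
  have hcirc : Continuous fun t ↦ circ b n t ω :=
    continuous_pi fun i ↦ continuous_pi fun j ↦ (hω _).div_const _
  simp only [fluct, integral_trace hb hn hp]
  exact ((hcirc.pow p).matrix_trace.sub (continuous_integral_realPart hb hn p)).const_mul _

lemma ae_fluct_zero_eq_zero (hb : IsBrownianFamily b P) {p : ℕ} (hp : p ≠ 0) (n : ℕ) :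
    ∀ᵐ ω ∂P, fluct P b p n 0 ω = 0 := by
  have h : ∀ᵐ ω ∂P, ∀ i, b i 0 ω = 0 := ae_all_iff.2 fun i ↦ (hb.brownian i).eval_zero_ae_eq_zero
  have htr : ∀ᵐ ω ∂P, (circ b n 0 ω ^ p).trace = 0 := by
    filter_upwards [h] with ω hω
    have h1 : circ b n 0 ω = 0 := by
      ext i j
      simp [circ, hω]
    rw [h1, zero_pow hp, Matrix.trace_zero]
  have hint : ∫ ω, (circ b n 0 ω ^ p).trace ∂P = 0 := by
    rw [integral_congr_ae htr, integral_zero]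
  filter_upwards [htr] with ω hω
  rw [fluct, hω, hint, sub_zero, mul_zero]

lemma hasMoments_fluct (hb : IsBrownianFamily b P) (p n : ℕ) (t : ℝ≥0) :
    HasMoments (fluct P b p n t) P :=
  have := hb.isProbabilityMeasure
  ((hasMoments_trace hb p n t).sub (HasMoments.const _)).const_mul _

lemma lintegral_enorm_pow_four_le {g : Ω → ℝ} (hg : HasMoments g P) [IsProbabilityMeasure P]
    {C : ℝ} (hC : ∫ ω, g ω ^ 4 ∂P ≤ C) : ∫⁻ ω, ‖g ω‖ₑ ^ 4 ∂P ≤ ENNReal.ofReal C := by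
  refine le_trans (le_of_eq ?_) (ENNReal.ofReal_le_ofReal hC)
  rw [ofReal_integral_eq_lintegral_ofReal (hg.pow 4).integrable
    (ae_of_all _ fun ω ↦ by positivity)]
  refine lintegral_congr fun ω ↦ ?_
  rw [Real.enorm_eq_ofReal_abs, ← ENNReal.ofReal_pow (abs_nonneg _), Even.pow_abs (by decide)]

/-- Convergence in distribution of the fluctuation process to the limit process. -/
lemma tendstoInDistribution_path_fluct [IsProbabilityMeasure P] (hb : IsBrownianFamily b P) {p : ℕ}
    (hp : p ≠ 0) {Ω' : Type*} [MeasurableSpace Ω'] {Q : Measure Ω'} [IsProbabilityMeasure Q]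
    {N : ℝ≥0 → Ω' → ℝ} (hN : IsLimitProcess p N Q) :
    TendstoInDistribution (fun n : ℕ ↦ path (fluct P b p n)) atTop (path N) (fun _ ↦ P) Q := by
  choose C hC0 hC using fun T : ℕ ↦ exists_integral_fluct_sub_pow_four_le hb hp (T : ℝ≥0)
  refine tendstoInDistribution_path
    (fun n t ↦ (hasMoments_fluct hb p n t).aestronglyMeasurable.aemeasurable)
    (ae_continuous_fluct hb hp) (ae_fluct_zero_eq_zero hb hp) hC0 (fun T n s t hst ht ↦ ?_)
    hN.gaussian.aemeasurable hN.continuous_paths fun w ↦ ?_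
  · exact lintegral_enorm_pow_four_le
      ((hasMoments_fluct hb p n t).sub (hasMoments_fluct hb p n s)) (hC T n hst ht)
  · have h := integral_exp_sum_of_isGaussianProcess hN.gaussian hN.mean_zero hN.covariance
      w.support w
    simp only [sum_range_f hp, mul_one] at h
    simp only [Finsupp.sum]
    rw [h]
    exact tendsto_integral_exp_fluct hb hp w.support w

end Paths

end CirculantFluctuation

theorem theorem3 {Ω : Type*} [MeasurableSpace Ω] (P : Measure Ω) [IsProbabilityMeasure P]
    (b : ℕ → ℝ≥0 → Ω → ℝ) (hb : ∀ i, IsBrownianReal (b i) P)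
    (hindep : iIndepFun (fun i ω t ↦ b i t ω) P) (p : ℕ) (hp : 2 ≤ p) :
    -- the centring is a genuine expectation and the fluctuation is a continuous process
    (∀ n t, Integrable (fun ω ↦ (circ b n t ω ^ p).trace) P) ∧
    (∀ n, ∀ᵐ ω ∂P, Continuous fun t ↦ fluct P b p n t ω) ∧
    -- the limit process exists, with a law on `C[0,∞)`
    (∃ ν : ProbabilityMeasure C(ℝ≥0, ℝ),
      IsLimitProcess p (fun t x ↦ x t) (ν : Measure C(ℝ≥0, ℝ))) ∧
    -- convergence in distribution on `C[0,∞)` to every version of the limit process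
    ∀ (Ω' : Type*) [MeasurableSpace Ω'] (Q : Measure Ω') [IsProbabilityMeasure Q]
      (N : ℝ≥0 → Ω' → ℝ), IsLimitProcess p N Q →
      TendstoInDistribution (fun n : ℕ ↦ path (fluct P b p n)) atTop (path N)
        (fun _ ↦ P) Q := by
  have h : IsBrownianFamily b P := ⟨hb, hindep⟩
  have hp0 : p ≠ 0 := by omega
  refine ⟨fun n t ↦ (hasMoments_trace h p n t).integrable, ae_continuous_fluct h hp0, ?_,
    fun Ω' _ Q _ N hN ↦ tendstoInDistribution_path_fluct h hp0 hN⟩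
  -- The given motion `b 0` already supplies the limit process; its path law is the required
  -- measure.
  have hN := IsLimitProcess.of_isBrownianReal (hb 0) hp0
  have hpath := aemeasurable_path hN.gaussian.aemeasurable hN.continuous_paths
  exact ⟨⟨_, Measure.isProbabilityMeasure_map hpath⟩, hN.map_path⟩
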